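/- **Setting.** Let $M$ be a connected smooth $d$-dimensional manifold (Hausdorff, second countable, without boundary). A smooth vector field $X$ on $M$ is *exponentiable* if it generates a global smooth flow $e^{tX}$, $t\in\mathbb R$. Composites of the flows $e^X:M\times[0,1]\to M$, $(m,t)\mapsto e^{tX}(m)$, are formed by concatenation. The *flow group* $\mathcal F$ is the group generated by these flows, where composites agreeing up to a reparametrization of $[0,1]$ (a monotone increasing, piecewise smooth bijection) are identified, $e^Xe^{-X}$ is identified with the trivial flow $I$, and $I$ is the unit. It acts on $M$ by time-one diffeomorphisms $m\mapsto F(m)$, and on $C_c^\infty(M)$ by $F(f)=f\circ F^{-1}$. For $A\subset M$, $F_1$ is *locally over $A$ a reparametrization* of $F_2$ if there are composites of flows representing $F_1,F_2$ such that for each $a\in A$ the path from $a$ given by the first is a reparametrization of the path from $a$ given by the second. The *flow algebra* $\mathcal FM$ is the quotient of the crossed product $\mathcal F\ltimes C_c^\infty(M)$ (the linear span of formal products $fF$, with $f_1F_1\,f_2F_2=f_1F_1(f_2)\,F_1F_2$ and $(fF)^*=F^{-1}(\overline f)F^{-1}$) by the $*$-ideal generated by all $F_1f-F_2f=F_1(f)F_1-F_2(f)F_2$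 with $F_1$ locally a reparametrization of $F_2$ over $\operatorname{supp} f$. Let $\mathcal H_n$ be a separable complex Hilbert space of dimension $n\in\{1,2,\dots,\infty\}$, and let $\mathcal U(\mathcal H_n)=U(n)$ be its unitary group. A map $u:M\to\mathcal U(\mathcal H_n)$ is *measurable* if $m\mapsto u(m)v$ is measurable for every $v\in\mathcal H_n$. "Almost everywhere" refers to the measure class of the smooth positive densities on $M$. A *measurable $U(n)$-connection* $\nabla$ assigns to every $F\in\mathcal F$ a measurable map $\nabla(F):M\to\mathcal U(\mathcal H_n)$ such that 1. $\nabla(1)=1$ a.e.; 2. for all $F_1,F_2\in\mathcal F$: $\nabla(F_1F_2)(m)=\nabla(F_1)(m)\,\nabla(F_2)(F_1^{-1}(m))$ for a.e. $m$; 3. if $F_1$ is locally over $U\subset M$ a reparametrization of $F_2$, then $\nabla(F_1)(m)=\nabla(F_2)(m)$ for a.e. $m$ with $F_1^{-1}(m)\in U$. Fix any smooth positive density on $M$, with associated measure $\mu$, and identify the space $L^2(M,\Omega^{1/2}\otimes\mathcal H_n)$ of $\mathcal H_n$-valued half-densities with $L^2(M,\mu;\mathcal H_n)$ by $\sqrt\mu\otimes\xi\leftrightarrow\xi$.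 The connection $\nabla$ defines a $*$-representation $\varphi_\nabla$ of $\mathcal FM$ on this space by $$(\varphi_\nabla(fF)\xi)(m)=f(m)\,\sqrt{\frac{d(F_*\mu)}{d\mu}(m)}\;\nabla(F)(m)\,\xi(F^{-1}(m)).$$ **Proposition.** Let $\nabla_1,\nabla_2$ be measurable $U(n)$-connections. Then $\varphi_{\nabla_1}$ and $\varphi_{\nabla_2}$ are unitarily equivalent, i.e. there is a unitary $U$ on $L^2(M,\Omega^{1/2}\otimes\mathcal H_n)$ with $\varphi_{\nabla_1}(a)=U^*\varphi_{\nabla_2}(a)U$ for all $a\in\mathcal FM$, if and only if $\nabla_1$ and $\nabla_2$ are measurably gauge equivalent, i.e. there is a measurable map $u:M\to\mathcal U(\mathcal H_n)$ such that for every $F\in\mathcal F$ $$\nabla_1(F)(m)=u(m)\,\nabla_2(F)(m)\,u(F^{-1}(m))^*\qquad\text{for almost every } m\in M.$$ -/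

import Mathlib

open Set Filter Topology MeasureTheory
open scoped Manifold ContDiff ENNReal NNReal

namespace FlowAlgebra

noncomputable section

set_option linter.unusedSectionVars false

/-! ### Exponentiable vector fields and their flows -/

/-- A smooth vector field on the `d`-dimensional manifold `M` that can be exponentiated: it generates
a global flow, i.e. a smooth map `(t, m) ↦ e^{tX}(m)` on `ℝ × M` which is the identity at `t = 0`
and all of whose trajectories are integral curves of the field. -/
structure ExpField (d : ℕ) (M : Type*) [TopologicalSpace M]
    [ChartedSpace (EuclideanSpace ℝ (Fin d)) M] [IsManifold (𝓡 d) ∞ M] where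
  /-- the underlying vector field -/
  field : ∀ m : M, TangentSpace (𝓡 d) m
  smooth_field : ContMDiff (𝓡 d) (𝓡 d).tangent ∞
    (fun m => (⟨m, field m⟩ : TangentBundle (𝓡 d) M))
  exists_flow : ∃ Φ : ℝ → M → M,
    ContMDiff (𝓘(ℝ, ℝ).prod (𝓡 d)) (𝓡 d) ∞ (fun p : ℝ × M => Φ p.1 p.2) ∧
    (∀ m, Φ 0 m = m) ∧
    ∀ m, IsMIntegralCurve (I := 𝓡 d) (fun t => Φ t m) field

variable {d : ℕ} {M : Type*} [TopologicalSpace M]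
  [ChartedSpace (EuclideanSpace ℝ (Fin d)) M] [IsManifold (𝓡 d) ∞ M]

namespace ExpField

/-- The flow `e^{tX}` of an exponentiable vector field `X`. -/
def flow (X : ExpField d M) : ℝ → M → M := X.exists_flow.choose

lemma contMDiff_flow (X : ExpField d M) :
    ContMDiff (𝓘(ℝ, ℝ).prod (𝓡 d)) (𝓡 d) ∞ (fun p : ℝ × M => X.flow p.1 p.2) :=
  X.exists_flow.choose_spec.1

lemma contMDiff_flow_time (X : ExpField d M) (t : ℝ) :
    ContMDiff (𝓡 d) (𝓡 d) ∞ (X.flow t) :=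
  X.contMDiff_flow.comp (contMDiff_const.prodMk contMDiff_id)

lemma flow_zero (X : ExpField d M) (m : M) : X.flow 0 m = m :=
  X.exists_flow.choose_spec.2.1 m

lemma isMIntegralCurve_flow (X : ExpField d M) (m : M) :
    IsMIntegralCurve (I := 𝓡 d) (fun t => X.flow t m) X.field :=
  X.exists_flow.choose_spec.2.2 m

variable [T2Space M]

/-- Integral curves of an exponentiable field are its flow lines. -/
lemma eq_flow (X : ExpField d M) {γ : ℝ → M} (hγ : IsMIntegralCurve (I := 𝓡 d) γ X.field) (t : ℝ) :
    γ t = X.flow t (γ 0) := by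
  have := isMIntegralCurve_Ioo_eq_of_contMDiff_boundaryless (I := 𝓡 d) (t₀ := 0)
    (X.smooth_field.of_le (by simp)) hγ (X.isMIntegralCurve_flow (γ 0)) (by simp [flow_zero])
  exact congrFun this t

lemma flow_add (X : ExpField d M) (s t : ℝ) (m : M) :
    X.flow (s + t) m = X.flow s (X.flow t m) := by
  have := X.eq_flow ((X.isMIntegralCurve_flow m).comp_add t) s
  simpa using this

lemma flow_of_field_eq_neg (X Y : ExpField d M) (h : ∀ m, Y.field m = -X.field m) (t : ℝ) (m : M) :
    Y.flow t m = X.flow (-t) m := by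
  have h1 := (X.isMIntegralCurve_flow m).comp_mul (-1)
  have h2 : IsMIntegralCurve (I := 𝓡 d) ((fun t => X.flow t m) ∘ (· * (-1 : ℝ))) Y.field := by
    have : Y.field = (-1 : ℝ) • X.field := by
      funext m; simp [h m]
    rw [this]; exact h1
  have h3 := Y.eq_flow h2 t
  simpa [flow_zero] using h3.symm

lemma flow_of_field_eq_zero (X : ExpField d M) (h : ∀ m, X.field m = 0) (t : ℝ) (m : M) :
    X.flow t m = m := by
  have := X.eq_flow (isMIntegralCurve_const (x := m) (h m)) t
  simpa using this.symm

/-- The time-one diffeomorphism of the flow, as a permutation of `M`. -/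
def timeOne (X : ExpField d M) : Equiv.Perm M where
  toFun := X.flow 1
  invFun := X.flow (-1)
  left_inv m := by rw [← flow_add]; simp [flow_zero]
  right_inv m := by rw [← flow_add]; simp [flow_zero]

end ExpField

/-! ### The flow group -/

/-- Formal composites of flows. `exp X` stands for the flow `t ↦ e^{tX}`, `0 ≤ t ≤ 1`, and
`comp w₁ w₂` for the composite `w₁ ∘ w₂` (first run through `w₂`, then through `w₁`). -/
inductive FlowWord (d : ℕ) (M : Type*) [TopologicalSpace M]
    [ChartedSpace (EuclideanSpace ℝ (Fin d)) M] [IsManifold (𝓡 d) ∞ M] where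
  | exp (X : ExpField d M) : FlowWord d M
  | comp (w₁ w₂ : FlowWord d M) : FlowWord d M

namespace FlowWord

/-- The map `M × [0,1] → M` given by a composite of flows; only times in `[0,1]` matter. -/
def path : FlowWord d M → M → ℝ → M
  | exp X, m, t => X.flow t m
  | comp w₁ w₂, m, t => if t ≤ 1 / 2 then w₂.path m (2 * t) else w₁.path (w₂.path m 1) (2 * t - 1)

/-- The element of the free group on the exponentiable vector fields spelled by a composite. -/
def spell : FlowWord d M → FreeGroup (ExpField d M)
  | exp X => FreeGroup.of X
  | comp w₁ w₂ => w₁.spell * w₂.spell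

end FlowWord

/-- `φ` restricts to a monotone, piecewise smooth bijection of `[0,1]`. -/
def IsReparam (φ : ℝ → ℝ) : Prop :=
  MonotoneOn φ (Icc 0 1) ∧ BijOn φ (Icc 0 1) (Icc 0 1) ∧
  ∃ s : Finset ℝ, ∀ a b : ℝ, 0 ≤ a → a < b → b ≤ 1 → (∀ x ∈ s, x ∉ Ioo a b) →
    ContDiffOn ℝ ∞ φ (Icc a b)

/-- Two composites of flows are the same modulo reparametrization. -/
def SameModReparam (w₁ w₂ : FlowWord d M) : Prop :=
  ∃ φ, IsReparam φ ∧ ∀ m, ∀ t ∈ Icc (0 : ℝ) 1, w₁.path m t = w₂.path m (φ t)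

/-- The identifications defining the flow group: composites that agree modulo reparametrization,
`e^X e^{-X} = I`, and `I = 1` for the trivial flow `I` (the flow of the zero field). -/
inductive FlowRel (d : ℕ) (M : Type*) [TopologicalSpace M]
    [ChartedSpace (EuclideanSpace ℝ (Fin d)) M] [IsManifold (𝓡 d) ∞ M] :
    FreeGroup (ExpField d M) → Prop
  | reparam (w₁ w₂ : FlowWord d M) (h : SameModReparam w₁ w₂) :
      FlowRel d M (w₁.spell * w₂.spell⁻¹)
  | cancel (X Y : ExpField d M) (h : ∀ m, Y.field m = -X.field m) :
      FlowRel d M (FreeGroup.of X * FreeGroup.of Y)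
  | trivial (X : ExpField d M) (h : ∀ m, X.field m = 0) :
      FlowRel d M (FreeGroup.of X)

/-- The flow group `𝓕`: the group generated by the flows of exponentiable vector fields,
modulo the identifications `FlowRel`. -/
abbrev FlowGroup (d : ℕ) (M : Type*) [TopologicalSpace M]
    [ChartedSpace (EuclideanSpace ℝ (Fin d)) M] [IsManifold (𝓡 d) ∞ M] : Type _ :=
  PresentedGroup {r | FlowRel d M r}

/-- The element of the flow group represented by a composite of flows. -/
def FlowWord.toGroup (w : FlowWord d M) : FlowGroup d M := PresentedGroup.mk _ w.spell

/-- `F₁` is, locally over `A`, a reparametrization of `F₂`: for suitable representing composites of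
flows, each path starting in `A` traced out by `F₁` is a reparametrization of that of `F₂`. -/
def LocalReparam (A : Set M) (F₁ F₂ : FlowGroup d M) : Prop :=
  ∃ w₁ w₂ : FlowWord d M, w₁.toGroup = F₁ ∧ w₂.toGroup = F₂ ∧
    ∀ a ∈ A, ∃ φ, IsReparam φ ∧ ∀ t ∈ Icc (0 : ℝ) 1, w₁.path a t = w₂.path a (φ t)

lemma IsReparam.map_one {φ : ℝ → ℝ} (h : IsReparam φ) : φ 1 = 1 := by
  obtain ⟨hm, hb, -⟩ := h
  obtain ⟨x, hx, hx1⟩ := hb.surjOn (show (1 : ℝ) ∈ Icc (0 : ℝ) 1 by simp)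
  have h1 := hm hx (show (1 : ℝ) ∈ Icc (0 : ℝ) 1 by simp) hx.2
  have h2 := (hb.mapsTo (show (1 : ℝ) ∈ Icc (0 : ℝ) 1 by simp)).2
  linarith

variable [T2Space M]

lemma FlowWord.path_one (w : FlowWord d M) (m : M) :
    w.path m 1 = FreeGroup.lift ExpField.timeOne w.spell m := by
  induction w generalizing m with
  | exp X => simp [path, spell, ExpField.timeOne]
  | comp w₁ w₂ h₁ h₂ =>
    have : ¬ ((1 : ℝ) ≤ 1 / 2) := by norm_num
    simp only [path, spell, if_neg this, map_mul, Equiv.Perm.mul_apply, ← h₂]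
    rw [← h₁]; norm_num

/-- The action of the flow group on `M` by time-one diffeomorphisms. -/
def FlowGroup.toPerm : FlowGroup d M →* Equiv.Perm M :=
  PresentedGroup.toGroup (f := ExpField.timeOne) (by
    rintro r (⟨w₁, w₂, φ, hφ, h⟩ | ⟨X, Y, h⟩ | ⟨X, h⟩)
    · rw [map_mul, map_inv, mul_inv_eq_one]
      ext m
      rw [← FlowWord.path_one, ← FlowWord.path_one, h m 1 (by simp), hφ.map_one]
    · ext m
      simp only [map_mul, FreeGroup.lift_apply_of, Equiv.Perm.mul_apply, ExpField.timeOne,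
        Equiv.coe_fn_mk, Equiv.Perm.coe_one, id]
      rw [X.flow_of_field_eq_neg Y h, ← X.flow_add]
      simp [ExpField.flow_zero]
    · ext m
      simpa [ExpField.timeOne] using X.flow_of_field_eq_zero h 1 m)

instance : MulAction (FlowGroup d M) M := MulAction.compHom M FlowGroup.toPerm

lemma FlowGroup.smul_def (F : FlowGroup d M) (m : M) : F • m = toPerm F m := rfl

lemma FlowWord.path_one_eq_smul (w : FlowWord d M) (m : M) : w.path m 1 = w.toGroup • m :=
  w.path_one m

lemma LocalReparam.smul_eq {A : Set M} {F₁ F₂ : FlowGroup d M} (h : LocalReparam A F₁ F₂)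
    {a : M} (ha : a ∈ A) : F₁ • a = F₂ • a := by
  obtain ⟨w₁, w₂, rfl, rfl, h⟩ := h
  obtain ⟨φ, hφ, h⟩ := h a ha
  rw [← FlowWord.path_one_eq_smul, ← FlowWord.path_one_eq_smul, h 1 (by simp), hφ.map_one]

lemma FlowGroup.contMDiff_smul (F : FlowGroup d M) :
    ContMDiff (𝓡 d) (𝓡 d) ∞ (fun m : M => F • m) := by
  have key : ∀ X : ExpField d M, ContMDiff (𝓡 d) (𝓡 d) ∞ (X.timeOne : M → M) ∧
      ContMDiff (𝓡 d) (𝓡 d) ∞ (X.timeOne⁻¹ : Equiv.Perm M) := fun X =>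
    ⟨X.contMDiff_flow_time 1, X.contMDiff_flow_time (-1)⟩
  induction F using PresentedGroup.induction_on with
  | _ z =>
  change ContMDiff (𝓡 d) (𝓡 d) ∞ (fun m : M => FreeGroup.lift ExpField.timeOne z m)
  induction z using FreeGroup.induction_on with
  | C1 => rw [map_one]; exact contMDiff_id
  | of X => simpa using (key X).1
  | inv_of X _ => simpa using (key X).2
  | mul x y hx hy => simpa [Function.comp_def] using hx.comp hy

lemma FlowGroup.continuous_smul (F : FlowGroup d M) : Continuous (fun m : M => F • m) :=
  (FlowGroup.contMDiff_smul F).continuous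

/-! ### The flow algebra -/

/-- The `*`-algebra `C_c^∞(M)` of smooth compactly supported complex functions on `M`. -/
def SmoothCc (d : ℕ) (M : Type*) [TopologicalSpace M]
    [ChartedSpace (EuclideanSpace ℝ (Fin d)) M] : NonUnitalStarSubalgebra ℂ (M → ℂ) where
  carrier := {f | ContMDiff (𝓡 d) 𝓘(ℝ, ℂ) ∞ f ∧ HasCompactSupport f}
  add_mem' hf hg := ⟨hf.1.add hg.1, hf.2.add hg.2⟩
  zero_mem' := ⟨contMDiff_const, HasCompactSupport.zero⟩
  mul_mem' {f g} hf hg := by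
    refine ⟨?_, hf.2.mul_right⟩
    have : ContDiff ℝ ∞ (fun p : ℂ × ℂ => p.1 * p.2) := contDiff_fst.mul contDiff_snd
    exact this.contMDiff.comp (hf.1.prodMk_space hg.1)
  smul_mem' c f hf := by
    refine ⟨?_, ?_⟩
    · have : ContDiff ℝ ∞ (fun z : ℂ => c * z) := contDiff_const.mul contDiff_id
      exact this.contMDiff.comp hf.1
    · exact hf.2.comp_left (g := fun z => c • z) (by simp)
  star_mem' {f} hf := by
    refine ⟨?_, ?_⟩
    · exact (Complex.conjCLE.contDiff (n := ∞)).contMDiff.comp hf.1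
    · exact hf.2.comp_left (g := fun z => star z) (by simp)

/-- The action `F(f) = f ∘ F⁻¹` of the flow group on `C_c^∞(M)`. -/
def act (F : FlowGroup d M) : SmoothCc d M →ₗ[ℂ] SmoothCc d M where
  toFun f := ⟨fun m => f.1 (F⁻¹ • m), f.2.1.comp (FlowGroup.contMDiff_smul F⁻¹), by
    have h := f.2.2.comp_homeomorph (f := f.1)
      ⟨MulAction.toPerm (F⁻¹ : FlowGroup d M), FlowGroup.continuous_smul F⁻¹, by
        exact FlowGroup.continuous_smul (F⁻¹)⁻¹⟩
    exact h⟩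
  map_add' _ _ := rfl
  map_smul' _ _ := rfl

lemma act_apply (F : FlowGroup d M) (f : SmoothCc d M) (m : M) :
    (act F f).1 m = f.1 (F⁻¹ • m) := rfl

lemma act_one (f : SmoothCc d M) : act (1 : FlowGroup d M) f = f := by
  ext m; simp [act_apply]

lemma act_act (F G : FlowGroup d M) (f : SmoothCc d M) : act F (act G f) = act (F * G) f := by
  ext m; simp [act_apply, mul_smul]

lemma act_mul (F : FlowGroup d M) (f g : SmoothCc d M) : act F (f * g) = act F f * act F g := rfl

lemma act_star (F : FlowGroup d M) (f : SmoothCc d M) : act F (star f) = star (act F f) := rfl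

/-- The crossed product `𝓕 ⋉ C_c^∞(M)`: formal linear combinations of products `f F`, with
`f ∈ C_c^∞(M)` and `F ∈ 𝓕`, encoded by the coefficient function of each `F`. -/
def Crossed (d : ℕ) (M : Type*) [TopologicalSpace M]
    [ChartedSpace (EuclideanSpace ℝ (Fin d)) M] [IsManifold (𝓡 d) ∞ M] : Type _ :=
  FlowGroup d M →₀ SmoothCc d M

namespace Crossed

instance : AddCommGroup (Crossed d M) := inferInstanceAs (AddCommGroup (FlowGroup d M →₀ _))

instance : Module ℂ (Crossed d M) := inferInstanceAs (Module ℂ (FlowGroup d M →₀ _))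

/-- The formal product `f F`. -/
def mono (f : SmoothCc d M) (F : FlowGroup d M) : Crossed d M := Finsupp.single F f

/-- `(f F) (g G) = f F(g) F G`, extended bilinearly. -/
instance : Mul (Crossed d M) where
  mul a b := Finsupp.sum a fun F f => Finsupp.sum b fun G g => mono (f * act F g) (F * G)

/-- `(f F)^* = F⁻¹(f̄) F⁻¹`, extended conjugate-linearly. -/
instance : Star (Crossed d M) where
  star a := Finsupp.sum a fun F f => mono (act F⁻¹ (star f)) F⁻¹

lemma mul_def (a b : Crossed d M) : a * b =
    Finsupp.sum a fun F f => Finsupp.sum b fun G g => mono (f * act F g) (F * G) := rfl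

lemma star_def (a : Crossed d M) :
    star a = Finsupp.sum a fun F f => mono (act F⁻¹ (star f)) F⁻¹ := rfl

lemma mono_add (f g : SmoothCc d M) (F : FlowGroup d M) :
    mono (f + g) F = mono f F + mono g F := Finsupp.single_add F f g

lemma mono_zero (F : FlowGroup d M) : mono (0 : SmoothCc d M) F = 0 := Finsupp.single_zero F

lemma smul_mono (c : ℂ) (f : SmoothCc d M) (F : FlowGroup d M) :
    c • mono f F = mono (c • f) F := Finsupp.smul_single c F f

lemma induction {p : Crossed d M → Prop} (a : Crossed d M) (h0 : p 0)
    (hadd : ∀ a b, p a → p b → p (a + b)) (hm : ∀ f F, p (mono f F)) : p a :=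
  Finsupp.induction_linear a h0 (fun a b ha hb => hadd a b ha hb) (fun F f => hm f F)

lemma mono_mul_mono (f g : SmoothCc d M) (F G : FlowGroup d M) :
    mono f F * mono g G = mono (f * act F g) (F * G) := by
  rw [mul_def, mono, mono, Finsupp.sum_single_index, Finsupp.sum_single_index]
  · simp [mono_zero]
  · simp [mono_zero, Finsupp.sum]

lemma star_mono (f : SmoothCc d M) (F : FlowGroup d M) :
    star (mono f F) = mono (act F⁻¹ (star f)) F⁻¹ := by
  rw [star_def, mono, Finsupp.sum_single_index]
  simp [mono_zero]

protected lemma add_mul' (a b c : Crossed d M) : (a + b) * c = a * c + b * c := by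
  rw [mul_def, mul_def, mul_def]
  refine Finsupp.sum_add_index' (f := a) (g := b) ?_ ?_
  · intro F; simp [mono_zero, Finsupp.sum]
  · intro F f g
    simp [Finsupp.sum, add_mul, mono_add, Finset.sum_add_distrib]

protected lemma mul_add' (a b c : Crossed d M) : a * (b + c) = a * b + a * c := by
  rw [mul_def, mul_def, mul_def]
  refine (Finsupp.sum_congr fun F _ => ?_).trans Finsupp.sum_add
  refine Finsupp.sum_add_index' (f := b) (g := c) ?_ ?_
  · intro G; simp [mono_zero]
  · intro G f g
    simp [mul_add, mono_add]

protected lemma star_add' (a b : Crossed d M) : star (a + b) = star a + star b := by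
  refine Finsupp.sum_add_index' (f := a) (g := b) ?_ ?_
  · intro F; simp [mono_zero]
  · intro F f g
    simp [mono_add]

protected lemma zero_mul' (a : Crossed d M) : 0 * a = 0 := Finsupp.sum_zero_index

protected lemma mul_zero' (a : Crossed d M) : a * 0 = 0 := by
  have := Crossed.mul_add' a 0 0
  simpa using this

protected lemma star_zero' : star (0 : Crossed d M) = 0 := Finsupp.sum_zero_index

instance : NonUnitalRing (Crossed d M) where
  left_distrib := Crossed.mul_add'
  right_distrib := Crossed.add_mul'
  zero_mul := Crossed.zero_mul'
  mul_zero := Crossed.mul_zero'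
  mul_assoc a b c := by
    induction a using Crossed.induction with
    | h0 => simp only [Crossed.zero_mul']
    | hadd a a' ha ha' => simp only [Crossed.add_mul', ha, ha']
    | hm f F =>
    induction b using Crossed.induction with
    | h0 => simp only [Crossed.zero_mul', Crossed.mul_zero']
    | hadd a a' ha ha' => simp only [Crossed.add_mul', Crossed.mul_add', ha, ha']
    | hm g G =>
    induction c using Crossed.induction with
    | h0 => simp only [Crossed.mul_zero']
    | hadd a a' ha ha' => simp only [Crossed.mul_add', ha, ha']
    | hm h H => simp only [mono_mul_mono, act_mul, act_act, mul_assoc]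

instance : StarRing (Crossed d M) where
  star_involutive a := by
    induction a using Crossed.induction with
    | h0 => simp only [Crossed.star_zero']
    | hadd a a' ha ha' => simp only [Crossed.star_add', ha, ha']
    | hm f F => simp [star_mono, act_star, act_act, act_one]
  star_mul a b := by
    induction a using Crossed.induction with
    | h0 => simp only [Crossed.zero_mul', Crossed.mul_zero', Crossed.star_zero']
    | hadd a a' ha ha' => simp only [Crossed.add_mul', Crossed.mul_add', Crossed.star_add', ha, ha']
    | hm f F =>
    induction b using Crossed.induction with
    | h0 => simp only [Crossed.zero_mul', Crossed.mul_zero', Crossed.star_zero']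
    | hadd a a' ha ha' => simp only [Crossed.add_mul', Crossed.mul_add', Crossed.star_add', ha, ha']
    | hm g G =>
      simp [star_mono, mono_mul_mono, act_star, act_act, act_mul, mul_comm]
  star_add := Crossed.star_add'

instance : IsScalarTower ℂ (Crossed d M) (Crossed d M) where
  smul_assoc c a b := by
    simp only [smul_eq_mul]
    induction a using Crossed.induction with
    | h0 => simp
    | hadd a a' ha ha' => simp only [smul_add, add_mul, ha, ha']
    | hm f F =>
    induction b using Crossed.induction with
    | h0 => simp
    | hadd a a' ha ha' => simp only [smul_add, mul_add, ha, ha']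
    | hm g G => simp only [smul_mono, mono_mul_mono, smul_mul_assoc]

instance : SMulCommClass ℂ (Crossed d M) (Crossed d M) where
  smul_comm c a b := by
    simp only [smul_eq_mul]
    induction a using Crossed.induction with
    | h0 => simp
    | hadd a a' ha ha' => simp only [smul_add, add_mul, ha, ha']
    | hm f F =>
    induction b using Crossed.induction with
    | h0 => simp
    | hadd a a' ha ha' => simp only [smul_add, mul_add, ha, ha']
    | hm g G => simp only [smul_mono, mono_mul_mono, map_smul, mul_smul_comm]

instance : StarModule ℂ (Crossed d M) where
  star_smul c a := by
    induction a using Crossed.induction with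
    | h0 => simp
    | hadd a a' ha ha' => simp only [smul_add, star_add, ha, ha']
    | hm f F => simp only [smul_mono, star_mono, star_smul, map_smul]

end Crossed

/-- The `*`-ideal of `𝓕 ⋉ C_c^∞(M)` generated by the elements `F₁ f - F₂ f = F₁(f) F₁ - F₂(f) F₂`
for which `F₁` is a local reparametrization of `F₂` over `supp f`. -/
def reparamIdeal (d : ℕ) (M : Type*) [TopologicalSpace M] [T2Space M]
    [ChartedSpace (EuclideanSpace ℝ (Fin d)) M] [IsManifold (𝓡 d) ∞ M] :
    Submodule ℂ (Crossed d M) :=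
  sInf {J | (∀ (F₁ F₂ : FlowGroup d M) (f : SmoothCc d M), LocalReparam (tsupport f.1) F₁ F₂ →
        Crossed.mono (act F₁ f) F₁ - Crossed.mono (act F₂ f) F₂ ∈ J) ∧
      ∀ x ∈ J, star x ∈ J ∧ ∀ a, a * x ∈ J ∧ x * a ∈ J}

lemma reparamIdeal_closed {x : Crossed d M} (hx : x ∈ reparamIdeal d M) :
    star x ∈ reparamIdeal d M ∧
      ∀ a, a * x ∈ reparamIdeal d M ∧ x * a ∈ reparamIdeal d M := by
  simp only [reparamIdeal, Submodule.mem_sInf, Set.mem_ofPred_eq] at hx ⊢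
  exact ⟨fun J hJ => (hJ.2 x (hx J hJ)).1,
    fun a => ⟨fun J hJ => ((hJ.2 x (hx J hJ)).2 a).1, fun J hJ => ((hJ.2 x (hx J hJ)).2 a).2⟩⟩

/-- The ring congruence of the ideal `reparamIdeal`. -/
def reparamCon (d : ℕ) (M : Type*) [TopologicalSpace M] [T2Space M]
    [ChartedSpace (EuclideanSpace ℝ (Fin d)) M] [IsManifold (𝓡 d) ∞ M] :
    RingCon (Crossed d M) where
  r a b := a - b ∈ reparamIdeal d M
  iseqv := ⟨fun a => by simp, fun {a b} h => by simpa using neg_mem h,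
    fun {a b c} h h' => by simpa using add_mem h h'⟩
  add' {a b c e} h h' := by
    have := add_mem h h'
    rwa [sub_add_sub_comm] at this
  mul' {a b c e} h h' := by
    have h1 := ((reparamIdeal_closed h).2 c).2
    have h2 := ((reparamIdeal_closed h').2 b).1
    have := add_mem h1 h2
    rw [sub_mul, mul_sub] at this
    simpa using this

/-- The flow algebra `𝓕M = 𝓕 ⋉ C_c^∞(M) / I`. -/
def FlowAlg (d : ℕ) (M : Type*) [TopologicalSpace M] [T2Space M]
    [ChartedSpace (EuclideanSpace ℝ (Fin d)) M] [IsManifold (𝓡 d) ∞ M] : Type _ :=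
  (reparamCon d M).Quotient

namespace FlowAlg

instance : NonUnitalRing (FlowAlg d M) := inferInstanceAs (NonUnitalRing (reparamCon d M).Quotient)

/-- The quotient map `𝓕 ⋉ C_c^∞(M) → 𝓕M`. -/
def mk : Crossed d M →ₙ+* FlowAlg d M where
  toFun a := (reparamCon d M).toQuotient a
  map_mul' _ _ := rfl
  map_zero' := rfl
  map_add' _ _ := rfl

lemma mk_surjective : Function.Surjective (mk : Crossed d M → FlowAlg d M) :=
  Quotient.mk''_surjective

lemma mk_eq_mk {a b : Crossed d M} : mk a = mk b ↔ a - b ∈ reparamIdeal d M :=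
  RingCon.eq (reparamCon d M)

instance : SMul ℂ (FlowAlg d M) where
  smul c := Quotient.map' (fun a => c • a) fun a b (h : a - b ∈ reparamIdeal d M) =>
    show c • a - c • b ∈ _ by rw [← smul_sub]; exact Submodule.smul_mem _ c h

lemma mk_smul (c : ℂ) (a : Crossed d M) : mk (c • a) = c • mk a := rfl

instance : Module ℂ (FlowAlg d M) :=
  Function.Surjective.module ℂ (mk : Crossed d M →ₙ+* FlowAlg d M).toAddMonoidHom mk_surjective
    mk_smul

instance : Star (FlowAlg d M) where
  star := Quotient.map' star fun a b (h : a - b ∈ reparamIdeal d M) =>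
    show star a - star b ∈ _ by rw [← star_sub]; exact (reparamIdeal_closed h).1

lemma mk_star (a : Crossed d M) : mk (star a) = star (mk a) := rfl

instance : StarRing (FlowAlg d M) where
  star_involutive a := by
    obtain ⟨a, rfl⟩ := mk_surjective a
    rw [← mk_star, ← mk_star, star_star]
  star_mul a b := by
    obtain ⟨a, rfl⟩ := mk_surjective a
    obtain ⟨b, rfl⟩ := mk_surjective b
    simp only [← mk_star, ← map_mul, star_mul]
  star_add a b := by
    obtain ⟨a, rfl⟩ := mk_surjective a
    obtain ⟨b, rfl⟩ := mk_surjective b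
    simp only [← mk_star, ← map_add, star_add]

end FlowAlg

/-! ### Smooth measures and their quasi-invariance -/

/-- `μ` is given by a smooth positive density on `M`: in every chart it has a smooth positive
density with respect to Lebesgue measure. (The Riemannian volume measures are of this kind.) -/
class IsSmoothDensity (d : ℕ) {M : Type*} [TopologicalSpace M]
    [ChartedSpace (EuclideanSpace ℝ (Fin d)) M] [MeasurableSpace M] (μ : Measure M) : Prop where
  chart : ∀ e ∈ atlas (EuclideanSpace ℝ (Fin d)) M, ∃ ρ : EuclideanSpace ℝ (Fin d) → ℝ,
    ContDiffOn ℝ ∞ ρ e.target ∧ (∀ y ∈ e.target, 0 < ρ y) ∧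
    ∀ A : Set M, MeasurableSet A → A ⊆ e.source → μ A = ∫⁻ y in e '' A, ENNReal.ofReal (ρ y)

section Measure

variable [SecondCountableTopology M] [MeasurableSpace M] [BorelSpace M]
  (μ : Measure M)

lemma measurableSet_image_chart (e : OpenPartialHomeomorph M (EuclideanSpace ℝ (Fin d)))
    {A : Set M} (hA : MeasurableSet A) (h : A ⊆ e.source) : MeasurableSet (e '' A) := by
  have h1 : e '' A = e.target ∩ e.symm ⁻¹' A := by
    rw [e.image_eq_target_inter_inv_preimage h]
  rw [h1]
  have h2 : Measurable (fun y : e.target => e.symm y) :=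
    (continuousOn_iff_continuous_domRestrict.mp e.continuousOn_symm).measurable
  have h3 : e.target ∩ e.symm ⁻¹' A =
      Subtype.val '' ((fun y : e.target => e.symm y) ⁻¹' A) := by
    ext y; simp [and_comm]
  rw [h3]
  exact e.open_target.measurableSet.subtype_image (h2 hA)

lemma null_iff [IsSmoothDensity d μ] (e : OpenPartialHomeomorph M (EuclideanSpace ℝ (Fin d)))
    (he : e ∈ atlas (EuclideanSpace ℝ (Fin d)) M) {A : Set M} (hA : MeasurableSet A)
    (h : A ⊆ e.source) : μ A = 0 ↔ volume (e '' A) = 0 := by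
  obtain ⟨ρ, hρ, hpos, hμ⟩ := IsSmoothDensity.chart (μ := μ) e he
  rw [hμ A hA h]
  have hsub : e '' A ⊆ e.target := by
    rintro _ ⟨x, hx, rfl⟩; exact e.map_source (h hx)
  have hmeas := measurableSet_image_chart e hA h
  have haem : AEMeasurable (fun y => ENNReal.ofReal (ρ y)) (volume.restrict (e '' A)) :=
    ENNReal.measurable_ofReal.comp_aemeasurable
      ((hρ.continuousOn.mono hsub).aemeasurable hmeas)
  rw [lintegral_eq_zero_iff' haem]
  constructor
  · intro h0
    have h1 : ∀ᵐ y ∂(volume.restrict (e '' A)), False := by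
      filter_upwards [h0, ae_restrict_mem hmeas] with y hy hy'
      simp only [Pi.zero_apply, ENNReal.ofReal_eq_zero] at hy
      exact absurd (hpos y (hsub hy')) (not_lt.mpr hy)
    simpa [ae_iff] using h1
  · intro h0
    rw [Measure.restrict_eq_zero.mpr h0, ae_zero]
    exact Filter.eventually_bot

variable (d) in
lemma isLocallyFiniteMeasure [IsSmoothDensity d μ] : IsLocallyFiniteMeasure μ := by
  refine ⟨fun x => ?_⟩
  set e := chartAt (EuclideanSpace ℝ (Fin d)) x with he
  obtain ⟨ρ, hρ, hpos, hμ⟩ := IsSmoothDensity.chart (μ := μ) e (chart_mem_atlas _ x)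
  have hx : e x ∈ e.target := e.map_source (mem_chart_source _ x)
  obtain ⟨r, hr, hball⟩ := Metric.nhds_basis_closedBall.mem_iff.mp (e.open_target.mem_nhds hx)
  set A := e.source ∩ e ⁻¹' Metric.ball (e x) r with hA
  have hAo : IsOpen A := e.isOpen_inter_preimage Metric.isOpen_ball
  refine ⟨A, hAo.mem_nhds ⟨mem_chart_source _ x, Metric.mem_ball_self hr⟩, ?_⟩
  rw [hμ A hAo.measurableSet inter_subset_left]
  have hsub : e '' A ⊆ Metric.closedBall (e x) r := by
    rintro _ ⟨y, hy, rfl⟩; exact Metric.ball_subset_closedBall hy.2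
  refine lt_of_le_of_lt (lintegral_mono_set hsub) ?_
  have hint : IntegrableOn ρ (Metric.closedBall (e x) r) :=
    (hρ.continuousOn.mono hball).integrableOn_compact (isCompact_closedBall _ _)
  refine lt_of_le_of_lt (lintegral_mono fun y => ?_) hint.2
  rw [← ofReal_norm]
  exact ENNReal.ofReal_le_ofReal (le_abs_self _)

variable (d) in
lemma sigmaFinite [IsSmoothDensity d μ] : SigmaFinite μ := by
  have := isLocallyFiniteMeasure d μ
  infer_instance

lemma measurable_smul (F : FlowGroup d M) : Measurable (fun m : M => F • m) :=
  (FlowGroup.continuous_smul F).measurable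

lemma quasiMeasurePreserving_smul [IsSmoothDensity d μ] (F : FlowGroup d M) :
    Measure.QuasiMeasurePreserving (fun m : M => F • m) μ μ := by
  refine ⟨measurable_smul F, Measure.AbsolutelyContinuous.mk fun N hN hN0 => ?_⟩
  rw [Measure.map_apply (measurable_smul F) hN]
  refine measure_null_of_locally_null _ fun x hx => ?_
  set e := chartAt (EuclideanSpace ℝ (Fin d)) x with he
  set e' := chartAt (EuclideanSpace ℝ (Fin d)) (F • x) with he'
  set O := e.source ∩ (fun m : M => F • m) ⁻¹' e'.source with hO
  have hOo : IsOpen O := e.open_source.inter (e'.open_source.preimage (FlowGroup.continuous_smul F))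
  have hxO : x ∈ O := ⟨mem_chart_source _ x, mem_chart_source _ (F • x)⟩
  set u := (fun m : M => F • m) ⁻¹' N ∩ O with hu
  have hum : MeasurableSet u := (measurable_smul F hN).inter hOo.measurableSet
  refine ⟨u, inter_mem_nhdsWithin _ (hOo.mem_nhds hxO), ?_⟩
  rw [null_iff μ e (chart_mem_atlas _ x) hum (fun m hm => hm.2.1)]
  have hN' : volume (e' '' (N ∩ e'.source)) = 0 := by
    rw [← null_iff μ e' (chart_mem_atlas _ _) (hN.inter e'.open_source.measurableSet)
      inter_subset_right]
    exact measure_mono_null inter_subset_left hN0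
  set t := (fun m : M => e' (F • m)) '' u with ht
  have ht0 : volume t = 0 := by
    refine measure_mono_null ?_ hN'
    rintro _ ⟨m, hm, rfl⟩
    exact ⟨F • m, ⟨hm.1, hm.2.2⟩, rfl⟩
  set g : EuclideanSpace ℝ (Fin d) → EuclideanSpace ℝ (Fin d) :=
    fun y => e (F⁻¹ • e'.symm y) with hg
  have himg : e '' u = g '' t := by
    rw [ht, image_image]
    refine image_congr fun m hm => ?_
    simp only [hg]
    rw [e'.left_inv hm.2.2, inv_smul_smul]
  rw [himg]
  refine addHaar_image_eq_zero_of_differentiableOn_of_addHaar_eq_zero _ ?_ ht0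
  rintro _ ⟨m, hm, rfl⟩
  have hd : ContMDiffAt 𝓘(ℝ, EuclideanSpace ℝ (Fin d)) 𝓘(ℝ, EuclideanSpace ℝ (Fin d)) ∞ g
      (e' (F • m)) := by
    have h1 : ContMDiffAt 𝓘(ℝ, EuclideanSpace ℝ (Fin d)) (𝓡 d) ∞ e'.symm (e' (F • m)) :=
      (contMDiffOn_chart_symm (I := 𝓡 d) (n := ∞) (x := F • x)).contMDiffAt
        (e'.open_target.mem_nhds (e'.map_source hm.2.2))
    have h2 : ContMDiffAt (𝓡 d) (𝓡 d) ∞ (fun m : M => F⁻¹ • m) (e'.symm (e' (F • m))) :=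
      (FlowGroup.contMDiff_smul F⁻¹).contMDiffAt
    have h3 : ContMDiffAt (𝓡 d) 𝓘(ℝ, EuclideanSpace ℝ (Fin d)) ∞ e
        (F⁻¹ • e'.symm (e' (F • m))) := by
      rw [e'.left_inv hm.2.2, inv_smul_smul]
      exact (contMDiffOn_chart (I := 𝓡 d) (n := ∞) (x := x)).contMDiffAt
        (e.open_source.mem_nhds hm.2.1)
    exact h3.comp (e' (F • m)) (h2.comp (e' (F • m)) h1)
  exact ((contMDiffAt_iff_contDiffAt.mp hd).differentiableAt (by simp)).differentiableWithinAt

/-- The Radon-Nikodym derivative `k_F = d(F_* μ) / dμ`. -/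
def weight (F : FlowGroup d M) : M → ℝ≥0∞ := (μ.map (fun m : M => F • m)).rnDeriv μ

lemma measurable_weight (F : FlowGroup d M) : Measurable (weight μ F) :=
  Measure.measurable_rnDeriv _ _

lemma measurableEmbedding_smul (F : FlowGroup d M) :
    MeasurableEmbedding (fun m : M => F • m) :=
  (MeasurableEquiv.mk (MulAction.toPerm F) (measurable_smul F)
    (measurable_smul F⁻¹)).measurableEmbedding

lemma sigmaFinite_map_smul [IsSmoothDensity d μ] (F : FlowGroup d M) :
    SigmaFinite (μ.map (fun m : M => F • m)) := by
  have := sigmaFinite d μ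
  exact (measurableEmbedding_smul F).sigmaFinite_map

lemma weight_lt_top [IsSmoothDensity d μ] (F : FlowGroup d M) : ∀ᵐ m ∂μ, weight μ F m < ⊤ := by
  have := sigmaFinite d μ
  have := sigmaFinite_map_smul μ F
  exact Measure.rnDeriv_lt_top _ _

lemma withDensity_weight [IsSmoothDensity d μ] (F : FlowGroup d M) :
    μ.withDensity (weight μ F) = μ.map (fun m : M => F • m) := by
  have := sigmaFinite d μ
  have := sigmaFinite_map_smul μ F
  exact Measure.withDensity_rnDeriv_eq _ _ (quasiMeasurePreserving_smul μ F).absolutelyContinuous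

lemma lintegral_weight [IsSmoothDensity d μ] (F : FlowGroup d M) (g : M → ℝ≥0∞)
    (hg : Measurable g) : ∫⁻ m, weight μ F m * g (F⁻¹ • m) ∂μ = ∫⁻ m, g m ∂μ := by
  have hg' : Measurable (fun m : M => g (F⁻¹ • m)) := hg.comp (measurable_smul F⁻¹)
  have := lintegral_withDensity_eq_lintegral_mul μ (measurable_weight μ F) hg'
  rw [withDensity_weight, lintegral_map hg' (measurable_smul F)] at this
  simpa using this.symm

lemma weight_one [IsSmoothDensity d μ] : ∀ᵐ m ∂μ, weight μ (1 : FlowGroup d M) m = 1 := by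
  have := sigmaFinite d μ
  have h : μ.map (fun m : M => (1 : FlowGroup d M) • m) = μ := by simp
  rw [weight, h]
  exact Measure.rnDeriv_self μ

lemma weight_mul [IsSmoothDensity d μ] (F G : FlowGroup d M) :
    ∀ᵐ m ∂μ, weight μ (F * G) m = weight μ F m * weight μ G (F⁻¹ • m) := by
  have := sigmaFinite d μ
  have := sigmaFinite_map_smul μ F
  have := sigmaFinite_map_smul μ G
  have h0 : μ.map (fun m : M => (F * G) • m) =
      (μ.map (fun m : M => G • m)).map (fun m : M => F • m) := by
    rw [Measure.map_map (measurable_smul F) (measurable_smul G)]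
    simp only [mul_smul, Function.comp_def]
  have hFG := sigmaFinite_map_smul μ (F * G)
  rw [h0] at hFG
  have hac : (μ.map (fun m : M => G • m)).map (fun m : M => F • m) ≪
      μ.map (fun m : M => F • m) :=
    (quasiMeasurePreserving_smul μ G).absolutelyContinuous.map (measurable_smul F)
  have h1 := Measure.rnDeriv_mul_rnDeriv (κ := μ) hac
  have h2 := (measurableEmbedding_smul F).rnDeriv_map (μ.map (fun m : M => G • m)) μ
  have h3 := (quasiMeasurePreserving_smul μ F⁻¹).ae h2
  filter_upwards [h1, h3] with m h1 h3
  simp only [smul_inv_smul] at h3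
  rw [weight, h0, ← h1, Pi.mul_apply, h3, mul_comm]
  rfl

lemma weight_inv [IsSmoothDensity d μ] (F : FlowGroup d M) :
    ∀ᵐ m ∂μ, weight μ F m * weight μ F⁻¹ (F⁻¹ • m) = 1 := by
  filter_upwards [weight_mul μ F F⁻¹, weight_one (d := d) μ] with m h1 h2
  rw [← h1, mul_inv_cancel, h2]

lemma weight_congr [IsSmoothDensity d μ] {A : Set M} (hA : MeasurableSet A)
    {F₁ F₂ : FlowGroup d M} (h : ∀ a ∈ A, F₁ • a = F₂ • a) :
    ∀ᵐ m ∂μ, F₁⁻¹ • m ∈ A → weight μ F₁ m = weight μ F₂ m := by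
  have := sigmaFinite d μ
  have := sigmaFinite_map_smul μ F₁
  have := sigmaFinite_map_smul μ F₂
  set B : Set M := (fun m : M => F₁⁻¹ • m) ⁻¹' A with hB
  have hBm : MeasurableSet B := measurable_smul F₁⁻¹ hA
  have hB2 : ∀ m, m ∈ B → F₂⁻¹ • m = F₁⁻¹ • m := by
    intro m hm
    rw [inv_smul_eq_iff, ← h _ hm, smul_inv_smul]
  have hB1 : ∀ (F : FlowGroup d M), (∀ a ∈ A, F • a ∈ B) → (∀ m ∈ B, F⁻¹ • m ∈ A) →
      (fun m : M => F • m) ⁻¹' B = A := by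
    intro F h1 h2
    ext a
    refine ⟨fun ha => ?_, fun ha => h1 a ha⟩
    have := h2 _ ha
    rwa [inv_smul_smul] at this
  have p1 : (fun m : M => F₁ • m) ⁻¹' B = A :=
    hB1 F₁ (fun a ha => by simpa [hB] using ha) (fun m hm => hm)
  have p2 : (fun m : M => F₂ • m) ⁻¹' B = A :=
    hB1 F₂ (fun a ha => by simpa [hB, ← h a ha] using ha) (fun m hm => by rw [hB2 m hm]; exact hm)
  have hres : (μ.map (fun m : M => F₁ • m)).restrict B =
      (μ.map (fun m : M => F₂ • m)).restrict B := by
    rw [Measure.restrict_map (measurable_smul F₁) hBm, Measure.restrict_map (measurable_smul F₂) hBm,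
      p1, p2]
    refine Measure.map_congr ?_
    filter_upwards [ae_restrict_mem hA] with a ha using h a ha
  have e1 := Measure.rnDeriv_restrict (μ.map (fun m : M => F₁ • m)) μ hBm
  have e2 := Measure.rnDeriv_restrict (μ.map (fun m : M => F₂ • m)) μ hBm
  rw [hres] at e1
  filter_upwards [e1, e2] with m e1 e2 hm
  rw [e1] at e2
  have hm' : m ∈ B := hm
  rw [Set.indicator_of_mem hm', Set.indicator_of_mem hm'] at e2
  exact e2

/-! ### Measurable connections -/

/-- The half-density factor `√(d(F_* μ) / dμ)`, for which
`(F⁻¹)^* √μ = √(d(F_* μ) / dμ) √μ`. -/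
def halfWeight (F : FlowGroup d M) (m : M) : ℝ := Real.sqrt (weight μ F m).toReal

end Measure

section Connection

variable [SecondCountableTopology M] [MeasurableSpace M] [BorelSpace M]
  {μ : Measure M}
  {H : Type*} [NormedAddCommGroup H] [InnerProductSpace ℂ H] [CompleteSpace H]

/-- A map from `M` to the unitary group of `H` is measurable if all its orbit maps are, i.e. it is
measurable for the strong operator topology. -/
def MeasurableUnitary (u : M → unitary (H →L[ℂ] H)) : Prop :=
  ∀ v : H, StronglyMeasurable fun m => (u m : H →L[ℂ] H) v

/-- A measurable `U(n)`-connection, where `n = dim H`. Measurable maps into the unitary group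
count as equal when they agree almost everywhere, so all identities hold almost everywhere.
Since `∇(F)(m)` is the transport from `F⁻¹(m)` to `m`, the restriction of `∇(F)` to `U` refers to the
transports starting in `U`. -/
structure MeasurableConnection (d : ℕ) {M : Type*} [TopologicalSpace M] [T2Space M]
    [ChartedSpace (EuclideanSpace ℝ (Fin d)) M] [IsManifold (𝓡 d) ∞ M] [MeasurableSpace M]
    (μ : Measure M) (H : Type*) [NormedAddCommGroup H] [InnerProductSpace ℂ H]
    [CompleteSpace H] where
  /-- the map `∇` -/
  toFun : FlowGroup d M → M → unitary (H →L[ℂ] H)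
  measurable' : ∀ F, MeasurableUnitary (toFun F)
  map_one' : ∀ᵐ m ∂μ, toFun 1 m = 1
  map_mul' : ∀ F₁ F₂, ∀ᵐ m ∂μ, toFun (F₁ * F₂) m = toFun F₁ m * toFun F₂ (F₁⁻¹ • m)
  local_reparam' : ∀ (U : Set M) (F₁ F₂ : FlowGroup d M), LocalReparam U F₁ F₂ →
    ∀ᵐ m ∂μ, F₁⁻¹ • m ∈ U → toFun F₁ m = toFun F₂ m

instance : CoeFun (MeasurableConnection d μ H)
    (fun _ => FlowGroup d M → M → unitary (H →L[ℂ] H)) := ⟨MeasurableConnection.toFun⟩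

/-- Two measurable connections are gauge equivalent if `∇₁(F)(m) = u(m) ∇₂(F)(m) u(F⁻¹(m))^*`
for a measurable gauge transform `u`. -/
def GaugeEquivalent (A₁ A₂ : MeasurableConnection d μ H) : Prop :=
  ∃ u : M → unitary (H →L[ℂ] H), MeasurableUnitary u ∧
    ∀ F : FlowGroup d M, ∀ᵐ m ∂μ, A₁ F m = u m * A₂ F m * star (u (F⁻¹ • m))

/-! ### The representation of the flow algebra defined by a connection -/

/-- The Hilbert space `L²(M, Ω^{1/2} ⊗ H)`: the function `ξ` stands for the `H`-valued half-density
`√μ ⊗ ξ`. -/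
abbrev HalfDensities (μ : Measure M) (H : Type*) [NormedAddCommGroup H] [InnerProductSpace ℂ H] :
    Type _ := Lp H 2 μ

lemma MeasurableUnitary.apply {u : M → unitary (H →L[ℂ] H)} (hu : MeasurableUnitary u)
    {ξ : M → H} (hξ : StronglyMeasurable ξ) :
    StronglyMeasurable fun m => (u m : H →L[ℂ] H) (ξ m) := by
  refine stronglyMeasurable_of_tendsto (f := fun n m => (u m : H →L[ℂ] H) (hξ.approx n m))
    atTop (fun n => ?_) ?_
  · have : (fun m => (u m : H →L[ℂ] H) (hξ.approx n m)) = fun m =>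
        ∑ y ∈ (hξ.approx n).range,
          (hξ.approx n ⁻¹' {y}).indicator (fun m => (u m : H →L[ℂ] H) y) m := by
      funext m
      rw [Finset.sum_eq_single (hξ.approx n m)]
      · simp
      · intro y _ hy
        rw [Set.indicator_of_notMem]
        simpa using hy.symm
      · intro h
        exact absurd (SimpleFunc.mem_range_self _ m) h
    rw [this]
    exact Finset.stronglyMeasurable_fun_sum _ fun y _ =>
      (hu y).indicator ((hξ.approx n).measurableSet_fiber y)
  · rw [tendsto_pi_nhds]
    intro m
    exact ((u m : H →L[ℂ] H).continuous.tendsto _).comp (hξ.tendsto_approx m)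

namespace MeasurableConnection

/-- The half-density `(φ_∇(f F) ξ)(m) = f(m) √k_F(m) ∇(F)(m) ξ(F⁻¹(m))`. -/
def transport (A : MeasurableConnection d μ H) (f : M → ℂ) (F : FlowGroup d M) (ξ : M → H)
    (m : M) : H :=
  (f m * (halfWeight μ F m : ℂ)) • (A F m : H →L[ℂ] H) (ξ (F⁻¹ • m))

lemma stronglyMeasurable_transport (A : MeasurableConnection d μ H) {f : M → ℂ}
    (hf : Measurable f) (F : FlowGroup d M) {ξ : M → H} (hξ : StronglyMeasurable ξ) :
    StronglyMeasurable (A.transport f F ξ) := by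
  refine StronglyMeasurable.smul ?_ ?_
  · exact (hf.mul (Complex.measurable_ofReal.comp (Real.continuous_sqrt.measurable.comp
      (measurable_weight μ F).ennreal_toReal))).stronglyMeasurable
  · exact (A.measurable' F).apply (hξ.comp_measurable (measurable_smul F⁻¹))

lemma transport_congr [IsSmoothDensity d μ] (A : MeasurableConnection d μ H) (f : M → ℂ)
    (F : FlowGroup d M) {ξ η : M → H} (h : ξ =ᵐ[μ] η) :
    A.transport f F ξ =ᵐ[μ] A.transport f F η := by
  filter_upwards [(quasiMeasurePreserving_smul μ F⁻¹).ae h] with m hm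
  simp [transport, hm]

lemma enorm_halfWeight_sq [IsSmoothDensity d μ] (F : FlowGroup d M) :
    ∀ᵐ m ∂μ, ‖(halfWeight μ F m : ℂ)‖ₑ ^ (2 : ℝ) = weight μ F m := by
  filter_upwards [weight_lt_top μ F] with m hm
  rw [halfWeight, ← ofReal_norm, Complex.norm_real, Real.norm_of_nonneg (Real.sqrt_nonneg _),
    ENNReal.ofReal_rpow_of_nonneg (Real.sqrt_nonneg _) (by norm_num), Real.rpow_two,
    Real.sq_sqrt ENNReal.toReal_nonneg, ENNReal.ofReal_toReal hm.ne]

lemma eLpNorm_transport_le [IsSmoothDensity d μ] (A : MeasurableConnection d μ H) {f : M → ℂ}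
    {C : ℝ} (hC : ∀ m, ‖f m‖ ≤ C) (F : FlowGroup d M) {ξ : M → H} (hξ : StronglyMeasurable ξ) :
    eLpNorm (A.transport f F ξ) 2 μ ≤ ENNReal.ofReal C * eLpNorm ξ 2 μ := by
  have h1 : eLpNorm (fun m => (halfWeight μ F m : ℂ) • (A F m : H →L[ℂ] H) (ξ (F⁻¹ • m))) 2 μ =
      eLpNorm ξ 2 μ := by
    rw [eLpNorm_eq_lintegral_rpow_enorm_toReal (by simp) (by simp),
      eLpNorm_eq_lintegral_rpow_enorm_toReal (by simp) (by simp)]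
    congr 1
    rw [← lintegral_weight μ F (fun m => ‖ξ m‖ₑ ^ (2 : ℝ≥0∞).toReal)
      (hξ.enorm.pow_const _)]
    refine lintegral_congr_ae ?_
    filter_upwards [enorm_halfWeight_sq (μ := μ) F] with m hm
    have hn : ‖(A F m : H →L[ℂ] H) (ξ (F⁻¹ • m))‖ₑ = ‖ξ (F⁻¹ • m)‖ₑ := by
      rw [← ofReal_norm, ← ofReal_norm,
        ContinuousLinearMap.norm_map_of_mem_unitary (A F m).2]
    simp only [ENNReal.toReal_ofNat]
    rw [enorm_smul, ENNReal.mul_rpow_of_nonneg _ _ (by norm_num), hm, hn]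
  rw [← h1]
  refine eLpNorm_le_mul_eLpNorm_of_ae_le_mul (Filter.Eventually.of_forall fun m => ?_) 2
  simp only [transport]
  rw [mul_smul, norm_smul]
  exact mul_le_mul_of_nonneg_right (hC m) (norm_nonneg _)

lemma exists_bound (f : SmoothCc d M) : ∃ C : ℝ, 0 ≤ C ∧ ∀ m, ‖f.1 m‖ ≤ C := by
  obtain ⟨C, hC⟩ := f.2.2.exists_bound_of_continuous f.2.1.continuous
  exact ⟨max C 0, le_max_right _ _, fun m => (hC m).trans (le_max_left _ _)⟩

lemma measurable_coe (f : SmoothCc d M) : Measurable f.1 := f.2.1.continuous.measurable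

lemma memLp_transport [IsSmoothDensity d μ] (A : MeasurableConnection d μ H) (f : SmoothCc d M)
    (F : FlowGroup d M) (ξ : HalfDensities μ H) : MemLp (A.transport f.1 F ξ) 2 μ := by
  obtain ⟨C, -, hC⟩ := exists_bound f
  refine ⟨(A.stronglyMeasurable_transport (measurable_coe f) F
    (Lp.stronglyMeasurable ξ)).aestronglyMeasurable, ?_⟩
  exact (A.eLpNorm_transport_le hC F (Lp.stronglyMeasurable ξ)).trans_lt
    (ENNReal.mul_lt_top ENNReal.ofReal_lt_top (Lp.memLp ξ).2)

/-- The bounded operator `φ_∇(f F)` on `L²(M, Ω^{1/2} ⊗ H)`. -/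
def op [IsSmoothDensity d μ] (A : MeasurableConnection d μ H) (f : SmoothCc d M)
    (F : FlowGroup d M) : HalfDensities μ H →L[ℂ] HalfDensities μ H :=
  LinearMap.mkContinuousOfExistsBound
    { toFun := fun ξ => (A.memLp_transport f F ξ).toLp
      map_add' := fun ξ η => by
        rw [← MemLp.toLp_add]
        refine MemLp.toLp_congr _ _ ((A.transport_congr f.1 F (Lp.coeFn_add ξ η)).trans ?_)
        exact Filter.Eventually.of_forall fun m => by simp [transport]
      map_smul' := fun c ξ => by
        rw [RingHom.id_apply, ← MemLp.toLp_const_smul]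
        refine MemLp.toLp_congr _ _ ((A.transport_congr f.1 F (Lp.coeFn_smul c ξ)).trans ?_)
        refine Filter.Eventually.of_forall fun m => ?_
        simp only [transport, Pi.smul_apply, map_smul]
        rw [smul_comm _ c] }
    (by
      obtain ⟨C, hC0, hC⟩ := exists_bound f
      refine ⟨C, fun ξ => ?_⟩
      simp only [LinearMap.coe_mk, AddHom.coe_mk]
      rw [Lp.norm_toLp, Lp.norm_def, ← ENNReal.toReal_ofReal hC0, ← ENNReal.toReal_mul]
      exact ENNReal.toReal_mono (ENNReal.mul_ne_top ENNReal.ofReal_ne_top (Lp.eLpNorm_ne_top ξ))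
        (A.eLpNorm_transport_le hC F (Lp.stronglyMeasurable ξ)))

lemma coeFn_op [IsSmoothDensity d μ] (A : MeasurableConnection d μ H) (f : SmoothCc d M)
    (F : FlowGroup d M) (ξ : HalfDensities μ H) :
    A.op f F ξ =ᵐ[μ] A.transport f.1 F ξ :=
  (A.memLp_transport f F ξ).coeFn_toLp

lemma op_add [IsSmoothDensity d μ] (A : MeasurableConnection d μ H) (f g : SmoothCc d M)
    (F : FlowGroup d M) : A.op (f + g) F = A.op f F + A.op g F := by
  ext1 ξ
  refine Lp.ext ?_
  rw [add_apply]
  filter_upwards [A.coeFn_op (f + g) F ξ, A.coeFn_op f F ξ, A.coeFn_op g F ξ,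
    Lp.coeFn_add (A.op f F ξ) (A.op g F ξ)] with m h1 h2 h3 h4
  rw [h4, Pi.add_apply, h1, h2, h3]
  simp [transport, add_mul, add_smul]

lemma op_smul [IsSmoothDensity d μ] (A : MeasurableConnection d μ H) (c : ℂ) (f : SmoothCc d M)
    (F : FlowGroup d M) : A.op (c • f) F = c • A.op f F := by
  ext1 ξ
  refine Lp.ext ?_
  rw [smul_apply]
  filter_upwards [A.coeFn_op (c • f) F ξ, A.coeFn_op f F ξ,
    Lp.coeFn_smul c (A.op f F ξ)] with m h1 h2 h3
  rw [h3, Pi.smul_apply, h1, h2]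
  simp [transport, mul_smul, mul_assoc]

lemma op_mul [IsSmoothDensity d μ] (A : MeasurableConnection d μ H) (f g : SmoothCc d M)
    (F G : FlowGroup d M) : A.op f F * A.op g G = A.op (f * act F g) (F * G) := by
  ext1 ξ
  refine Lp.ext ?_
  rw [mul_apply_eq_comp]
  filter_upwards [A.coeFn_op f F (A.op g G ξ),
    (quasiMeasurePreserving_smul μ F⁻¹).ae (A.coeFn_op g G ξ), A.coeFn_op (f * act F g) (F * G) ξ,
    weight_mul μ F G, A.map_mul' F G] with m h1 h2 h3 h4 h5
  rw [h1, h3]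
  simp only [transport, h2, h5, halfWeight, h4, ENNReal.toReal_mul,
    Real.sqrt_mul ENNReal.toReal_nonneg]
  simp only [map_smul, mul_inv_rev, mul_smul, Complex.ofReal_mul,
    NonUnitalStarSubalgebra.coe_mul, Pi.mul_apply, act_apply, Submonoid.coe_mul,
    mul_apply_eq_comp]
  rw [smul_comm ((Real.sqrt (weight μ F m).toReal : ℝ) : ℂ) (g.1 (F⁻¹ • m))]

lemma op_star [IsSmoothDensity d μ] (A : MeasurableConnection d μ H) (f : SmoothCc d M)
    (F : FlowGroup d M) : star (A.op f F) = A.op (act F⁻¹ (star f)) F⁻¹ := by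
  rw [ContinuousLinearMap.star_eq_adjoint, eq_comm, ContinuousLinearMap.eq_adjoint_iff]
  intro ξ η
  rw [L2.inner_def, L2.inner_def]
  have hk := withDensity_weight μ F
  have h0 : ∫ m, inner ℂ (A.op (act F⁻¹ (star f)) F⁻¹ ξ m) (η m) ∂μ =
      ∫ m, inner ℂ (A.op (act F⁻¹ (star f)) F⁻¹ ξ (F⁻¹ • m)) (η (F⁻¹ • m))
        ∂(μ.map (fun m : M => F • m)) := by
    rw [(measurableEmbedding_smul F).integral_map]
    simp
  rw [h0, ← hk, integral_withDensity_eq_integral_toReal_smul (measurable_weight μ F)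
    (weight_lt_top μ F)]
  refine integral_congr_ae ?_
  filter_upwards [A.coeFn_op f F η,
    (quasiMeasurePreserving_smul μ F⁻¹).ae (A.coeFn_op (act F⁻¹ (star f)) F⁻¹ ξ),
    weight_inv μ F, A.map_mul' F F⁻¹, A.map_one'] with m h1 h2 h3 h4 h5
  rw [mul_inv_cancel, h5] at h4
  have h6 : A F⁻¹ (F⁻¹ • m) = star (A F m) := by
    rw [Unitary.star_eq_inv]
    exact (inv_eq_of_mul_eq_one_right h4.symm).symm
  have h7 : (weight μ F m).toReal * (weight μ F⁻¹ (F⁻¹ • m)).toReal = 1 := by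
    rw [← ENNReal.toReal_mul, h3]; simp
  have h8 : (weight μ F m).toReal * Real.sqrt (weight μ F⁻¹ (F⁻¹ • m)).toReal =
      Real.sqrt (weight μ F m).toReal := by
    have h9 : Real.sqrt (weight μ F m).toReal * Real.sqrt (weight μ F⁻¹ (F⁻¹ • m)).toReal = 1 := by
      rw [← Real.sqrt_mul ENNReal.toReal_nonneg, h7, Real.sqrt_one]
    calc _ = Real.sqrt (weight μ F m).toReal * (Real.sqrt (weight μ F m).toReal *
          Real.sqrt (weight μ F⁻¹ (F⁻¹ • m)).toReal) := by
            rw [← mul_assoc, Real.mul_self_sqrt ENNReal.toReal_nonneg]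
      _ = _ := by rw [h9, mul_one]
  rw [h1, h2]
  simp only [transport, halfWeight, h6, inv_inv, smul_inv_smul, act_apply]
  simp only [inner_smul_left, inner_smul_right, map_mul, Complex.conj_ofReal]
  have h10 : inner ℂ (((star (A F m) : unitary (H →L[ℂ] H)) : H →L[ℂ] H) (ξ m)) (η (F⁻¹ • m)) =
      inner ℂ (ξ m) ((A F m : H →L[ℂ] H) (η (F⁻¹ • m))) := by
    rw [Unitary.coe_star, ContinuousLinearMap.star_eq_adjoint,
      ContinuousLinearMap.adjoint_inner_left]
  rw [h10, ← h8]
  have h11 : (starRingEnd ℂ) ((star f).1 m) = f.1 m := by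
    change star (star (f.1 m)) = _
    rw [star_star]
  rw [h11]
  simp only [Complex.real_smul, Complex.ofReal_mul]
  ring

lemma op_congr [IsSmoothDensity d μ] (A : MeasurableConnection d μ H) (f : SmoothCc d M)
    {F₁ F₂ : FlowGroup d M} (h : LocalReparam (tsupport f.1) F₁ F₂) :
    A.op (act F₁ f) F₁ = A.op (act F₂ f) F₂ := by
  ext1 ξ
  refine Lp.ext ?_
  filter_upwards [A.coeFn_op (act F₁ f) F₁ ξ, A.coeFn_op (act F₂ f) F₂ ξ,
    A.local_reparam' _ _ _ h,
    weight_congr μ (isClosed_tsupport f.1).measurableSet (fun a ha => h.smul_eq ha)]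
    with m h1 h2 h3 h4
  rw [h1, h2]
  simp only [transport, act_apply, halfWeight]
  by_cases hm : F₁⁻¹ • m ∈ tsupport f.1
  · have : F₂⁻¹ • m = F₁⁻¹ • m := by
      rw [inv_smul_eq_iff, ← h.smul_eq hm, smul_inv_smul]
    rw [this, h3 hm, h4 hm]
  · have hm2 : F₂⁻¹ • m ∉ tsupport f.1 := by
      intro h'
      apply hm
      have : F₁⁻¹ • m = F₂⁻¹ • m := by
        rw [inv_smul_eq_iff, h.smul_eq h', smul_inv_smul]
      rwa [this]
    rw [image_eq_zero_of_notMem_tsupport hm, image_eq_zero_of_notMem_tsupport hm2]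
    simp

/-- The representation of the crossed product: the linear extension of `f F ↦ φ_∇(f F)`. -/
def crossedRep [IsSmoothDensity d μ] (A : MeasurableConnection d μ H) :
    Crossed d M →ₗ[ℂ] (HalfDensities μ H →L[ℂ] HalfDensities μ H) :=
  Finsupp.lsum ℂ fun F : FlowGroup d M =>
    { toFun := fun f : SmoothCc d M => A.op f F
      map_add' := fun f g => A.op_add f g F
      map_smul' := fun c f => A.op_smul c f F }

lemma crossedRep_mono [IsSmoothDensity d μ] (A : MeasurableConnection d μ H) (f : SmoothCc d M)
    (F : FlowGroup d M) : A.crossedRep (Crossed.mono f F) = A.op f F := by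
  exact Finsupp.lsum_single ℂ _ F f

lemma crossedRep_mul [IsSmoothDensity d μ] (A : MeasurableConnection d μ H) (a b : Crossed d M) :
    A.crossedRep (a * b) = A.crossedRep a * A.crossedRep b := by
  induction a using Crossed.induction with
  | h0 => simp
  | hadd a a' ha ha' => simp only [add_mul, map_add, ha, ha']
  | hm f F =>
  induction b using Crossed.induction with
  | h0 => simp
  | hadd a a' ha ha' => simp only [mul_add, map_add, ha, ha']
  | hm g G => rw [Crossed.mono_mul_mono, crossedRep_mono, crossedRep_mono, crossedRep_mono, op_mul]

lemma crossedRep_star [IsSmoothDensity d μ] (A : MeasurableConnection d μ H) (a : Crossed d M) :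
    A.crossedRep (star a) = star (A.crossedRep a) := by
  induction a using Crossed.induction with
  | h0 => simp
  | hadd a a' ha ha' => simp only [star_add, map_add, ha, ha']
  | hm f F => rw [Crossed.star_mono, crossedRep_mono, crossedRep_mono, op_star]

lemma crossedRep_eq_zero [IsSmoothDensity d μ] (A : MeasurableConnection d μ H) {a : Crossed d M}
    (ha : a ∈ reparamIdeal d M) : A.crossedRep a = 0 := by
  have : reparamIdeal d M ≤ LinearMap.ker A.crossedRep := by
    refine sInf_le ⟨fun F₁ F₂ f h => ?_, fun x hx => ?_⟩
    · rw [LinearMap.mem_ker, map_sub, crossedRep_mono, crossedRep_mono, A.op_congr f h, sub_self]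
    · rw [LinearMap.mem_ker] at hx
      refine ⟨?_, fun a => ⟨?_, ?_⟩⟩
      · rw [LinearMap.mem_ker, crossedRep_star, hx, star_zero]
      · rw [LinearMap.mem_ker, crossedRep_mul, hx, mul_zero]
      · rw [LinearMap.mem_ker, crossedRep_mul, hx, zero_mul]
  exact this ha

/-- The representation `φ_∇` of the flow algebra on `L²(M, Ω^{1/2} ⊗ H)`. -/
def rep [IsSmoothDensity d μ] (A : MeasurableConnection d μ H) :
    FlowAlg d M →⋆ₙₐ[ℂ] (HalfDensities μ H →L[ℂ] HalfDensities μ H) where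
  toFun := Quotient.lift A.crossedRep fun a b (h : a - b ∈ reparamIdeal d M) =>
    sub_eq_zero.mp (by rw [← map_sub]; exact A.crossedRep_eq_zero h)
  map_smul' c a := by
    obtain ⟨a, rfl⟩ := FlowAlg.mk_surjective a
    exact map_smul A.crossedRep c a
  map_zero' := map_zero A.crossedRep
  map_add' a b := by
    obtain ⟨a, rfl⟩ := FlowAlg.mk_surjective a
    obtain ⟨b, rfl⟩ := FlowAlg.mk_surjective b
    exact map_add A.crossedRep a b
  map_mul' a b := by
    obtain ⟨a, rfl⟩ := FlowAlg.mk_surjective a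
    obtain ⟨b, rfl⟩ := FlowAlg.mk_surjective b
    exact A.crossedRep_mul a b
  map_star' a := by
    obtain ⟨a, rfl⟩ := FlowAlg.mk_surjective a
    exact A.crossedRep_star a

/-- `φ_∇` on the class of `f F` is the operator `ξ ↦ (m ↦ f(m) √k_F(m) ∇(F)(m) ξ(F⁻¹(m)))`. -/
lemma rep_mk_mono [IsSmoothDensity d μ] (A : MeasurableConnection d μ H) (f : SmoothCc d M)
    (F : FlowGroup d M) : A.rep (FlowAlg.mk (Crossed.mono f F)) = A.op f F :=
  A.crossedRep_mono f F

end MeasurableConnection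

end Connection

/-- Two representations of the flow algebra on Hilbert spaces `H₁`, `H₂` are unitarily equivalent
if `φ₁(a) = U^* φ₂(a) U` for some unitary `U : H₁ → H₂` and all `a`. -/
def UnitarilyEquivalent {H₁ H₂ : Type*} [NormedAddCommGroup H₁] [InnerProductSpace ℂ H₁]
    [CompleteSpace H₁] [NormedAddCommGroup H₂] [InnerProductSpace ℂ H₂] [CompleteSpace H₂]
    (φ₁ : FlowAlg d M →⋆ₙₐ[ℂ] (H₁ →L[ℂ] H₁)) (φ₂ : FlowAlg d M →⋆ₙₐ[ℂ] (H₂ →L[ℂ] H₂)) : Prop :=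
  ∃ U : H₁ ≃ₗᵢ[ℂ] H₂, ∀ (a : FlowAlg d M) (ξ : H₁), φ₁ a ξ = U.symm (φ₂ a (U ξ))

end

end FlowAlgebra

/-!
A unitary intertwining `φ_{∇₂}` and `φ_{∇₁}` intertwines in particular the operators `φ(f 1)`. For
every connection, `φ(f 1)` is multiplication by `f`, because `∇(1) = 1` and the Radon-Nikodym factor
of the identity is `1`. Hence such a unitary `V` of `L²(M; H)` commutes with multiplication by
functions in `C_c^∞(M)`, and it must be *decomposable*: `(V ξ)(m) = u(m) ξ(m)` for a measurable field
`u` of unitaries of `H`. The intertwining relation for `f F` then reads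
`u(m) ∇₂(F)(m) = ∇₁(F)(m) u(F⁻¹(m))`, since the scalar factors on the two sides agree. Conversely,
a gauge transform `u` acts on `L²(M; H)` as a unitary (`gaugeUnitary`), and the same computation
shows that it intertwines the representations (`gaugeUnitary_op`).

Decomposability is proved without the theory of direct integrals. Integrating against test functions
shows that `⟪V ξ, V η⟫ = ⟪ξ, η⟫` almost everywhere on `M`, not only after integration
(`ae_inner_eq_of_intertwines`). Take a positive function `h` in `L²` and a Hilbert basis `b` of `H`,
which is countable as `H` is separable. For almost every `m`, the vectors `h(m)⁻¹ V(h b_i)(m)` are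
orthonormal, and so are the vectors `h(m)⁻¹ V⁻¹(h b_i)(m)`; the isometries of `H` that they define
are adjoint to each other, hence unitary (`exists_unitary_apply_eq`). Fibrewise preservation of inner
products finally identifies `(V ξ)(m)` with the image of `ξ(m)`
(`exists_measurableUnitary_ae_eq`).
-/

namespace FlowAlgebra

/-! ### Orthonormal families in a Hilbert space -/

section HilbertSpace

variable {H : Type*} [NormedAddCommGroup H] [InnerProductSpace ℂ H]

lemma countable_of_orthonormal {ι : Type*} [TopologicalSpace.SeparableSpace H] {v : ι → H}
    (hv : Orthonormal ℂ v) : Countable ι := by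
  refine Pairwise.countable_of_isOpen_disjoint (s := fun i => Metric.ball (v i) (1 / 2))
    (fun i j hij => ?_) (fun i => Metric.isOpen_ball)
    (fun i => ⟨v i, Metric.mem_ball_self (by norm_num)⟩)
  -- Distinct members have distance `√2 > 1`, so the balls of radius `1 / 2` are disjoint.
  refine Metric.ball_disjoint_ball ?_
  have h2 : ‖v i - v j‖ ^ 2 = 2 := by
    rw [@norm_sub_sq ℂ, hv.1 i, hv.1 j, hv.2 hij]
    norm_num
  rw [dist_eq_norm]
  nlinarith [norm_nonneg (v i - v j)]

variable [CompleteSpace H]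

/-- The condition `⟪T i, b j⟫ = ⟪b i, T' j⟫` says that the isometries `b i ↦ T i` and
`b j ↦ T' j` are adjoint to each other; an isometry whose adjoint is isometric is unitary. -/
lemma exists_unitary_apply_eq {ι : Type*} (b : HilbertBasis ι ℂ H) {T T' : ι → H}
    (hT : Orthonormal ℂ T) (hT' : Orthonormal ℂ T')
    (h : ∀ i j, inner ℂ (T i) (b j) = inner ℂ (b i) (T' j)) :
    ∃ u : unitary (H →L[ℂ] H), ∀ i, (u : H →L[ℂ] H) (b i) = T i := by
  classical
  set S : H →ₗᵢ[ℂ] H := hT'.orthogonalFamily.linearIsometry.comp b.repr.toLinearIsometry with hS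
  have hSb : ∀ j, S (b j) = T' j := fun j => by
    simp [hS, b.repr_self, OrthogonalFamily.linearIsometry_apply_single]
  have hadj : ∀ i x, inner ℂ (T i) x = inner ℂ (b i) (S x) := fun i x => by
    have : innerSL ℂ (T i) = (innerSL ℂ (b i)).comp S.toContinuousLinearMap := by
      refine ContinuousLinearMap.ext_on
        (Submodule.dense_iff_topologicalClosure_eq_top.mpr b.dense_span) ?_
      rintro _ ⟨j, rfl⟩
      simp [h, hSb]
    simpa using DFunLike.congr_fun this x
  have hbot : (Submodule.span ℂ (range T))ᗮ = ⊥ := by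
    refine (Submodule.eq_bot_iff _).mpr fun x hx => ?_
    have h0 : S x = 0 := by
      refine b.repr.map_eq_zero_iff.mp (lp.ext (funext fun i => ?_))
      rw [b.repr_apply_apply, ← hadj]
      exact (Submodule.mem_orthogonal _ _).mp hx _ (Submodule.subset_span (mem_range_self i))
    exact (map_eq_zero_iff S S.injective).mp h0
  refine ⟨Unitary.linearIsometryEquiv.symm
    (b.repr.trans (HilbertBasis.mkOfOrthogonalEqBot hT hbot).repr.symm), fun i => ?_⟩
  rw [Unitary.coe_symm_linearIsometryEquiv_apply]
  have h1 := (HilbertBasis.mkOfOrthogonalEqBot hT hbot).repr_symm_single i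
  rw [HilbertBasis.coe_mkOfOrthogonalEqBot] at h1
  simp [b.repr_self, h1]

end HilbertSpace

/-! ### Measurable fields of unitaries -/

section Measurability

variable {M : Type*} [MeasurableSpace M] {H : Type*} [NormedAddCommGroup H] [InnerProductSpace ℂ H]
  [CompleteSpace H]

lemma measurableUnitary_of_hilbertBasis {ι : Type*} (b : HilbertBasis ι ℂ H)
    {u : M → unitary (H →L[ℂ] H)}
    (h : ∀ i, StronglyMeasurable fun m => (u m : H →L[ℂ] H) (b i)) : MeasurableUnitary u := by
  intro v
  have hv : v ∈ closure (Submodule.span ℂ (range b) : Set H) := by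
    have := (Submodule.dense_iff_topologicalClosure_eq_top.mpr b.dense_span) v
    exact this
  obtain ⟨x, hx, hlim⟩ := mem_closure_iff_seq_limit.mp hv
  refine stronglyMeasurable_of_tendsto (f := fun n m => (u m : H →L[ℂ] H) (x n)) atTop
    (fun n => ?_) (tendsto_pi_nhds.mpr fun m => ((u m : H →L[ℂ] H).continuous.tendsto _).comp hlim)
  refine Submodule.span_induction
    (p := fun y _ => StronglyMeasurable fun m => (u m : H →L[ℂ] H) y) ?_ ?_ ?_ ?_ (hx n)
  · rintro _ ⟨i, rfl⟩
    exact h i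
  · simpa using stronglyMeasurable_const
  · intro y z _ _ hy hz
    simp only [map_add]
    exact hy.add hz
  · intro c y _ hy
    simp only [map_smul]
    exact hy.const_smul c

/-- The strong operator measurability of the adjoints comes from weak measurability, which is
enough in a separable space. -/
lemma MeasurableUnitary.star [TopologicalSpace.SeparableSpace H] {u : M → unitary (H →L[ℂ] H)}
    (hu : MeasurableUnitary u) : MeasurableUnitary fun m => star (u m) := by
  intro v
  obtain ⟨w, b, -⟩ := exists_hilbertBasis ℂ H
  have := countable_of_orthonormal b.orthonormal
  refine stronglyMeasurable_of_tendsto (u := atTop)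
    (f := fun (s : Finset w) m => ∑ i ∈ s, inner ℂ ((u m : H →L[ℂ] H) (b i)) v • b i)
    (fun s => ?_) (tendsto_pi_nhds.mpr fun m => ?_)
  · exact Finset.stronglyMeasurable_fun_sum s fun i _ =>
      ((hu (b i)).inner stronglyMeasurable_const).smul_const (b i)
  · have h := b.hasSum_repr (((Star.star (u m) : unitary (H →L[ℂ] H)) : H →L[ℂ] H) v)
    have hi : ∀ i, inner ℂ ((u m : H →L[ℂ] H) (b i)) v =
        b.repr (((Star.star (u m) : unitary (H →L[ℂ] H)) : H →L[ℂ] H) v) i := fun i => by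
      rw [b.repr_apply_apply, Unitary.coe_star, ContinuousLinearMap.star_eq_adjoint,
        ContinuousLinearMap.adjoint_inner_right]
    simp only [hi]
    exact h

lemma unitary_star_apply (u : unitary (H →L[ℂ] H)) (v : H) :
    ((star u : unitary (H →L[ℂ] H)) : H →L[ℂ] H) ((u : H →L[ℂ] H) v) = v := by
  change (((star u * u : unitary (H →L[ℂ] H)) : H →L[ℂ] H)) v = v
  rw [Unitary.star_mul_self]
  rfl

end Measurability

/-! ### Unitaries of `L²` preserving fibrewise inner products -/

section Decomposition

variable {M : Type*} [MeasurableSpace M] {μ : Measure M}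

lemma exists_pos_memLp_two (μ : Measure M) [SigmaFinite μ] :
    ∃ h : M → ℝ, (∀ m, 0 < h m) ∧ Measurable h ∧ MemLp h 2 μ := by
  obtain ⟨g, hg0, hgm, hg⟩ := exists_pos_lintegral_lt_of_sigmaFinite μ (ε := 1) one_ne_zero
  have hgm' : Measurable fun m => Real.sqrt (g m : ℝ) :=
    Real.continuous_sqrt.measurable.comp hgm.coe_nnreal_real
  refine ⟨fun m => Real.sqrt (g m), fun m => Real.sqrt_pos.mpr (hg0 m), hgm', ?_⟩
  refine (memLp_two_iff_integrable_sq hgm'.aestronglyMeasurable).mpr ?_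
  have : (fun m => Real.sqrt (g m : ℝ) ^ 2) = fun m => (g m : ℝ) :=
    funext fun m => Real.sq_sqrt (g m).2
  rw [this]
  refine ⟨hgm.coe_nnreal_real.aestronglyMeasurable, ?_⟩
  simpa [HasFiniteIntegral] using hg.trans_le le_top

variable {H : Type*} [NormedAddCommGroup H] [InnerProductSpace ℂ H]

lemma memLp_ofReal_smul_const {h : M → ℝ} (hm : Measurable h) (hL : MemLp h 2 μ) (v : H) :
    MemLp (fun m => (h m : ℂ) • v) 2 μ := by
  refine (hL.mul_const ‖v‖).mono ?_ (Eventually.of_forall fun m => ?_)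
  · exact ((Complex.measurable_ofReal.comp hm).stronglyMeasurable.smul_const v).aestronglyMeasurable
  · simp [norm_smul]

variable [CompleteSpace H]

/-- A unitary of `L²(μ; H)` that preserves the inner products fibre by fibre acts by a measurable
field of unitaries. Up to a scalar function, the values of this field on a Hilbert basis `b` of `H`
are the images of the sections `h • b i`, where `h` is a positive `L²` function. -/
theorem exists_measurableUnitary_ae_eq [SigmaFinite μ] [TopologicalSpace.SeparableSpace H]
    (V : HalfDensities μ H ≃ₗᵢ[ℂ] HalfDensities μ H)
    (hV : ∀ ξ η, ∀ᵐ m ∂μ, inner ℂ (V ξ m) (V η m) = inner ℂ (ξ m) (η m)) :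
    ∃ u : M → unitary (H →L[ℂ] H), MeasurableUnitary u ∧
      ∀ ξ, ∀ᵐ m ∂μ, V ξ m = (u m : H →L[ℂ] H) (ξ m) := by
  classical
  obtain ⟨h, h0, hm, hL⟩ := exists_pos_memLp_two μ
  obtain ⟨w, b, -⟩ := exists_hilbertBasis ℂ H
  have := countable_of_orthonormal b.orthonormal
  set s : w → HalfDensities μ H := fun i => (memLp_ofReal_smul_const hm hL (b i)).toLp with hs
  have hsm : ∀ᵐ m ∂μ, ∀ i, s i m = (h m : ℂ) • b i :=
    ae_all_iff.mpr fun i => (memLp_ofReal_smul_const hm hL (b i)).coeFn_toLp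
  set T : w → M → H := fun i m => (h m : ℂ)⁻¹ • V (s i) m with hT
  set T' : w → M → H := fun i m => (h m : ℂ)⁻¹ • V.symm (s i) m with hT'
  have hV' : ∀ ξ η, ∀ᵐ m ∂μ, inner ℂ (V.symm ξ m) (V.symm η m) = inner ℂ (ξ m) (η m) := by
    intro ξ η
    filter_upwards [hV (V.symm ξ) (V.symm η)] with m hm
    simpa using hm.symm
  have hne : ∀ m, (h m : ℂ) ≠ 0 := fun m => by exact_mod_cast (h0 m).ne'
  -- Almost everywhere `b i ↦ T i m` extends to a unitary; the family `T'`, built from `V⁻¹`,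
  -- supplies the adjoint isometry.
  have hex : ∀ᵐ m ∂μ, ∃ u : unitary (H →L[ℂ] H), ∀ i, (u : H →L[ℂ] H) (b i) = T i m := by
    have e1 := ae_all_iff.mpr fun i => ae_all_iff.mpr fun j => hV (s i) (s j)
    have e2 := ae_all_iff.mpr fun i => ae_all_iff.mpr fun j => hV' (s i) (s j)
    have e3 := ae_all_iff.mpr fun i => ae_all_iff.mpr fun j => hV (s i) (V.symm (s j))
    filter_upwards [hsm, e1, e2, e3] with m hsm e1 e2 e3
    refine exists_unitary_apply_eq b (T := fun i => T i m) (T' := fun i => T' i m) ?_ ?_ ?_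
    · rw [orthonormal_iff_ite]
      intro i j
      simp only [hT, inner_smul_left, inner_smul_right, e1, hsm]
      rw [← orthonormal_iff_ite.mp b.orthonormal i j]
      simp [hne]
    · rw [orthonormal_iff_ite]
      intro i j
      simp only [hT', inner_smul_left, inner_smul_right, e2, hsm]
      rw [← orthonormal_iff_ite.mp b.orthonormal i j]
      simp [hne]
    · intro i j
      have := e3 i j
      simp only [LinearIsometryEquiv.apply_symm_apply, hsm, inner_smul_left, inner_smul_right,
        Complex.conj_ofReal] at this
      simp only [hT, hT', inner_smul_left, inner_smul_right, map_inv₀, Complex.conj_ofReal]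
      rw [mul_left_cancel₀ (hne m) this]
  obtain ⟨G, hGs, hGm, hG⟩ : ∃ G : Set M,
      (∀ m ∈ G, ∃ u : unitary (H →L[ℂ] H), ∀ i, (u : H →L[ℂ] H) (b i) = T i m) ∧
      MeasurableSet G ∧ ∀ᵐ m ∂μ, m ∈ G := by
    obtain ⟨G, hG, hGm, hGs⟩ := hex.exists_measurable_mem
    exact ⟨G, hGs, hGm, hG⟩
  choose! u₀ hu₀ using hGs
  -- Measurability is required at every point, so `u` is changed off a measurable conull set.
  set u : M → unitary (H →L[ℂ] H) := fun m => if m ∈ G then u₀ m else 1 with hu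
  refine ⟨u, measurableUnitary_of_hilbertBasis b fun i => ?_, fun ξ => ?_⟩
  · have hTm : StronglyMeasurable (T i) :=
      (Complex.measurable_ofReal.comp hm).inv.stronglyMeasurable.smul (Lp.stronglyMeasurable _)
    have : (fun m => (u m : H →L[ℂ] H) (b i)) = G.piecewise (T i) (fun _ => b i) := by
      funext m
      by_cases hmG : m ∈ G
      · simp [hu, hmG, hu₀ m hmG]
      · simp [hu, hmG]
    rw [this]
    exact hTm.piecewise hGm stronglyMeasurable_const
  · have e := ae_all_iff.mpr fun i => hV (s i) ξ
    filter_upwards [hG, hsm, e] with m hmG hsm e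
    -- `(u m)⋆ (V ξ m)` and `ξ m` have the same coordinates in the basis `b`.
    have key : ((star (u m) : unitary (H →L[ℂ] H)) : H →L[ℂ] H) (V ξ m) = ξ m := by
      refine b.repr.injective (lp.ext (funext fun i => ?_))
      rw [b.repr_apply_apply, b.repr_apply_apply, Unitary.coe_star,
        ContinuousLinearMap.star_eq_adjoint, ContinuousLinearMap.adjoint_inner_right]
      have : (u m : H →L[ℂ] H) (b i) = T i m := by simp [hu, hmG, hu₀ m hmG]
      rw [this, hT]
      simp only [inner_smul_left, e, hsm]
      simp [hne]
    rw [← key, ← unitary_star_apply (star (u m)) (V ξ m), star_star, unitary_star_apply]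

end Decomposition

/-! ### The unitary given by a gauge transform -/

section GaugeTransform

variable {M : Type*} [TopologicalSpace M] [T2Space M] [SecondCountableTopology M]
  [MeasurableSpace M] [BorelSpace M] {μ : Measure M}
  {H : Type*} [NormedAddCommGroup H] [InnerProductSpace ℂ H] [CompleteSpace H]

lemma memLp_unitary_apply {u : M → unitary (H →L[ℂ] H)} (hu : MeasurableUnitary u)
    (ξ : HalfDensities μ H) : MemLp (fun m => (u m : H →L[ℂ] H) (ξ m)) 2 μ :=
  (Lp.memLp ξ).of_le (hu.apply (Lp.stronglyMeasurable ξ)).aestronglyMeasurable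
    (Eventually.of_forall fun m =>
      (ContinuousLinearMap.norm_map_of_mem_unitary (u m).2 (ξ m)).le)

/-- The unitary of `L²(M, Ω^{1/2} ⊗ H)` given by a measurable gauge transform:
`ξ ↦ (m ↦ u(m) ξ(m))`. -/
noncomputable def gaugeUnitary [TopologicalSpace.SeparableSpace H] (μ : Measure M)
    {u : M → unitary (H →L[ℂ] H)} (hu : MeasurableUnitary u) :
    HalfDensities μ H ≃ₗᵢ[ℂ] HalfDensities μ H where
  toFun ξ := (memLp_unitary_apply hu ξ).toLp
  invFun ξ := (memLp_unitary_apply hu.star ξ).toLp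
  map_add' ξ η := by
    rw [← MemLp.toLp_add]
    refine MemLp.toLp_congr _ _ ?_
    filter_upwards [Lp.coeFn_add ξ η] with m hm
    rw [hm]
    simp
  map_smul' c ξ := by
    rw [RingHom.id_apply, ← MemLp.toLp_const_smul]
    refine MemLp.toLp_congr _ _ ?_
    filter_upwards [Lp.coeFn_smul c ξ] with m hm
    rw [hm]
    simp
  left_inv ξ := by
    refine Lp.ext ?_
    filter_upwards [(memLp_unitary_apply hu.star (memLp_unitary_apply hu ξ).toLp).coeFn_toLp,
      (memLp_unitary_apply hu ξ).coeFn_toLp] with m h1 h2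
    rw [h1, h2, unitary_star_apply]
  right_inv ξ := by
    refine Lp.ext ?_
    filter_upwards [(memLp_unitary_apply hu (memLp_unitary_apply hu.star ξ).toLp).coeFn_toLp,
      (memLp_unitary_apply hu.star ξ).coeFn_toLp] with m h1 h2
    rw [h1, h2]
    simpa using unitary_star_apply (star (u m)) (ξ m)
  norm_map' ξ := by
    change ‖(memLp_unitary_apply hu ξ).toLp‖ = ‖ξ‖
    rw [Lp.norm_toLp, Lp.norm_def]
    congr 1
    exact eLpNorm_congr_norm_ae (Eventually.of_forall fun m =>
      ContinuousLinearMap.norm_map_of_mem_unitary (u m).2 (ξ m))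

lemma coeFn_gaugeUnitary [TopologicalSpace.SeparableSpace H]
    {u : M → unitary (H →L[ℂ] H)} (hu : MeasurableUnitary u) (ξ : HalfDensities μ H) :
    ∀ᵐ m ∂μ, gaugeUnitary μ hu ξ m = (u m : H →L[ℂ] H) (ξ m) :=
  (memLp_unitary_apply hu ξ).coeFn_toLp

end GaugeTransform

/-! ### Operators intertwining the representations -/

section Connections

variable {d : ℕ} {M : Type*} [TopologicalSpace M] [T2Space M] [SecondCountableTopology M]
  [ChartedSpace (EuclideanSpace ℝ (Fin d)) M] [IsManifold (𝓡 d) ∞ M]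
  [MeasurableSpace M] [BorelSpace M] {μ : Measure M}
  {H : Type*} [NormedAddCommGroup H] [InnerProductSpace ℂ H] [CompleteSpace H]

/-- The fundamental lemma of the calculus of variations, for test functions in `SmoothCc`. -/
lemma ae_eq_zero_of_integral_smoothCc_smul [IsSmoothDensity d μ] {w : M → H}
    (hw : LocallyIntegrable w μ)
    (h : ∀ f : SmoothCc d M, ∫ m, f.1 m • w m ∂μ = 0) : ∀ᵐ m ∂μ, w m = 0 := by
  have := ChartedSpace.locallyCompactSpace (EuclideanSpace ℝ (Fin d)) M
  refine ae_eq_zero_of_integral_contMDiff_smul_eq_zero (𝓡 d) hw fun g hg hgc => ?_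
  have hf : (fun m => (g m : ℂ)) ∈ SmoothCc d M :=
    ⟨Complex.ofRealCLM.contDiff.contMDiff.comp hg, hgc.comp_left (g := Complex.ofReal) (by simp)⟩
  simpa using h ⟨_, hf⟩

namespace MeasurableConnection

lemma coeFn_op_one [IsSmoothDensity d μ] (A : MeasurableConnection d μ H) (f : SmoothCc d M)
    (ξ : HalfDensities μ H) : ∀ᵐ m ∂μ, A.op f 1 ξ m = f.1 m • ξ m := by
  filter_upwards [A.coeFn_op f 1 ξ, weight_one (d := d) μ, A.map_one'] with m h1 h2 h3
  simp [h1, transport, halfWeight, h2, h3]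

/-- Compare the integrals of both sides against `f ∈ C_c^∞(M)`: multiplication by `f` is
`φ_∇(f 1)` for every connection `∇`, so an isometry intertwining these operators preserves
`∫ f ⟪ξ, η⟫`. -/
theorem ae_inner_eq_of_intertwines [IsSmoothDensity d μ] (A B : MeasurableConnection d μ H)
    (V : HalfDensities μ H ≃ₗᵢ[ℂ] HalfDensities μ H)
    (hV : ∀ (f : SmoothCc d M) (ξ : HalfDensities μ H), V (A.op f 1 ξ) = B.op f 1 (V ξ))
    (ξ η : HalfDensities μ H) : ∀ᵐ m ∂μ, inner ℂ (V ξ m) (V η m) = inner ℂ (ξ m) (η m) := by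
  have i1 := L2.integrable_inner (𝕜 := ℂ) (V ξ) (V η)
  have i2 := L2.integrable_inner (𝕜 := ℂ) ξ η
  have key : ∀ᵐ m ∂μ, inner ℂ (V ξ m) (V η m) - inner ℂ (ξ m) (η m) = 0 := by
    refine ae_eq_zero_of_integral_smoothCc_smul (d := d) (i1.sub i2).locallyIntegrable fun f => ?_
    have hmul : ∀ (C : MeasurableConnection d μ H) (ζ θ : HalfDensities μ H),
        (fun m => f.1 m • inner ℂ (ζ m) (θ m)) =ᵐ[μ] fun m => inner ℂ (ζ m) (C.op f 1 θ m) := by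
      intro C ζ θ
      filter_upwards [C.coeFn_op_one f θ] with m hm
      rw [hm, inner_smul_right, smul_eq_mul]
    have j1 := (L2.integrable_inner (𝕜 := ℂ) (V ξ) (B.op f 1 (V η))).congr (hmul B _ _).symm
    have j2 := (L2.integrable_inner (𝕜 := ℂ) ξ (A.op f 1 η)).congr (hmul A _ _).symm
    simp only [smul_sub]
    rw [integral_sub j1 j2, integral_congr_ae (hmul B _ _), integral_congr_ae (hmul A _ _),
      ← L2.inner_def, ← L2.inner_def, ← hV, V.inner_map_map, sub_self]
  filter_upwards [key] with m hm using sub_eq_zero.mp hm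

end MeasurableConnection

/-- The operators with `F = 1` make `V` act by a measurable field `u` of unitaries. Applying
`V φ_B(f F) = φ_A(f F) V` to the sections `h • b i`, with `h` a positive `L²` function and `b` a
Hilbert basis of `H`, gives `f(m) u(m) ∇_B(F)(m) = f(m) ∇_A(F)(m) u(F⁻¹(m))` for every
`f ∈ C_c^∞(M)`, which is the gauge equivalence. -/
theorem gaugeEquivalent_of_intertwines [IsSmoothDensity d μ] [TopologicalSpace.SeparableSpace H]
    (A B : MeasurableConnection d μ H) (V : HalfDensities μ H ≃ₗᵢ[ℂ] HalfDensities μ H)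
    (hV : ∀ (f : SmoothCc d M) (F : FlowGroup d M) (ξ : HalfDensities μ H),
      V (B.op f F ξ) = A.op f F (V ξ)) : GaugeEquivalent A B := by
  have := sigmaFinite d μ
  have := isLocallyFiniteMeasure d μ
  obtain ⟨u, hu, hVu⟩ := exists_measurableUnitary_ae_eq V
    (B.ae_inner_eq_of_intertwines A V fun f ξ => hV f 1 ξ)
  refine ⟨u, hu, fun F => ?_⟩
  obtain ⟨h, h0, hm, hL⟩ := exists_pos_memLp_two μ
  obtain ⟨I, b, -⟩ := exists_hilbertBasis ℂ H
  have := countable_of_orthonormal b.orthonormal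
  have hne : ∀ m, (h m : ℂ) ≠ 0 := fun m => by exact_mod_cast (h0 m).ne'
  have hF : ∀ v : H, ∀ᵐ m ∂μ, (u m : H →L[ℂ] H) ((B F m : H →L[ℂ] H) v) -
      (A F m : H →L[ℂ] H) ((u (F⁻¹ • m) : H →L[ℂ] H) v) = 0 := by
    intro v
    have hwm : StronglyMeasurable fun m => (u m : H →L[ℂ] H) ((B F m : H →L[ℂ] H) v) -
        (A F m : H →L[ℂ] H) ((u (F⁻¹ • m) : H →L[ℂ] H) v) :=
      (hu.apply (B.measurable' F v)).sub
        ((A.measurable' F).apply ((hu v).comp_measurable (measurable_smul F⁻¹)))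
    have hwl : LocallyIntegrable (fun m => (u m : H →L[ℂ] H) ((B F m : H →L[ℂ] H) v) -
        (A F m : H →L[ℂ] H) ((u (F⁻¹ • m) : H →L[ℂ] H) v)) μ := by
      refine (locallyIntegrable_const (‖v‖ + ‖v‖)).mono hwm.aestronglyMeasurable
        (Eventually.of_forall fun m => ?_)
      refine (norm_sub_le _ _).trans ?_
      simp only [ContinuousLinearMap.norm_map_of_mem_unitary (Subtype.prop _)]
      exact le_abs_self _
    refine ae_eq_zero_of_integral_smoothCc_smul (d := d) hwl fun f => ?_
    have hmem := memLp_ofReal_smul_const hm hL v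
    set ξ : HalfDensities μ H := hmem.toLp with hξ
    rw [integral_eq_zero_of_ae]
    filter_upwards [hVu (B.op f F ξ), B.coeFn_op f F ξ, A.coeFn_op f F (V ξ),
      (quasiMeasurePreserving_smul μ F⁻¹).ae (hVu ξ),
      (quasiMeasurePreserving_smul μ F⁻¹).ae hmem.coeFn_toLp, weight_inv μ F,
      weight_lt_top μ F] with m e1 e2 e3 e4 e5 e6 e7
    rw [hV, e3, e2] at e1
    simp only [MeasurableConnection.transport, e4] at e1
    simp only [hξ, e5, map_smul] at e1
    -- `k_F > 0` almost everywhere because `k_F(m) k_{F⁻¹}(F⁻¹(m)) = 1`.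
    have hk : (halfWeight μ F m : ℂ) ≠ 0 := by
      have hw0 : weight μ F m ≠ 0 := fun h => by simp [h] at e6
      exact_mod_cast (Real.sqrt_pos.mpr (ENNReal.toReal_pos hw0 e7.ne)).ne'
    have e8 : (halfWeight μ F m * h (F⁻¹ • m) : ℂ) • f.1 m •
        ((u m : H →L[ℂ] H) ((B F m : H →L[ℂ] H) v) -
          (A F m : H →L[ℂ] H) ((u (F⁻¹ • m) : H →L[ℂ] H) v)) = 0 := by
      rw [smul_sub, smul_sub, sub_eq_zero]
      simp only [smul_smul] at e1 ⊢
      convert e1.symm using 2 <;> ring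
    exact (smul_eq_zero.mp e8).resolve_left (mul_ne_zero hk (hne _))
  filter_upwards [ae_all_iff.mpr fun i => hF (b i)] with m hm
  have hcomp : u m * B F m = A F m * u (F⁻¹ • m) := by
    refine Subtype.ext (ContinuousLinearMap.ext_on
      (Submodule.dense_iff_topologicalClosure_eq_top.mpr b.dense_span) ?_)
    rintro _ ⟨i, rfl⟩
    exact sub_eq_zero.mp (hm i)
  rw [hcomp, mul_assoc, Unitary.mul_star_self, mul_one]

lemma gaugeUnitary_op [IsSmoothDensity d μ] [TopologicalSpace.SeparableSpace H]
    (A B : MeasurableConnection d μ H) {u : M → unitary (H →L[ℂ] H)} (hu : MeasurableUnitary u)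
    {F : FlowGroup d M} (hF : ∀ᵐ m ∂μ, A F m = u m * B F m * star (u (F⁻¹ • m)))
    (f : SmoothCc d M) (ξ : HalfDensities μ H) :
    gaugeUnitary μ hu (B.op f F ξ) = A.op f F (gaugeUnitary μ hu ξ) := by
  refine Lp.ext ?_
  filter_upwards [coeFn_gaugeUnitary hu (B.op f F ξ), B.coeFn_op f F ξ,
    A.coeFn_op f F (gaugeUnitary μ hu ξ),
    (quasiMeasurePreserving_smul μ F⁻¹).ae (coeFn_gaugeUnitary hu ξ), hF] with m e1 e2 e3 e4 e5
  rw [e1, e2, e3]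
  simp only [MeasurableConnection.transport, e4, e5, map_smul, Submonoid.coe_mul,
    mul_apply_eq_comp, unitary_star_apply]

/-- It suffices to intertwine the operators of the products `f F`, since these span the crossed
product. Here `V` is the adjoint of the unitary in the definition of equivalence. -/
lemma unitarilyEquivalent_rep_iff [IsSmoothDensity d μ] (A B : MeasurableConnection d μ H) :
    UnitarilyEquivalent A.rep B.rep ↔ ∃ V : HalfDensities μ H ≃ₗᵢ[ℂ] HalfDensities μ H,
      ∀ (f : SmoothCc d M) (F : FlowGroup d M) (ξ : HalfDensities μ H),
        V (B.op f F ξ) = A.op f F (V ξ) := by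
  constructor
  · rintro ⟨U, hU⟩
    refine ⟨U.symm, fun f F ξ => ?_⟩
    have := hU (FlowAlg.mk (Crossed.mono f F)) (U.symm ξ)
    rw [A.rep_mk_mono, B.rep_mk_mono, U.apply_symm_apply] at this
    exact this.symm
  · rintro ⟨V, hV⟩
    refine ⟨V.symm, fun a ξ => ?_⟩
    obtain ⟨a, rfl⟩ := FlowAlg.mk_surjective a
    induction a using Crossed.induction with
    | h0 => simp
    | hadd a a' ha ha' => simp only [map_add, add_apply, ha, ha']
    | hm f F => simp [A.rep_mk_mono, B.rep_mk_mono, hV]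

end Connections

end FlowAlgebra

theorem mainTheorem2 {d : ℕ} {M : Type*} [TopologicalSpace M] [T2Space M]
    [SecondCountableTopology M] [ConnectedSpace M]
    [ChartedSpace (EuclideanSpace ℝ (Fin d)) M] [IsManifold (𝓡 d) ∞ M]
    [MeasurableSpace M] [BorelSpace M]
    (μ : Measure M) [FlowAlgebra.IsSmoothDensity d μ]
    {H : Type*} [NormedAddCommGroup H] [InnerProductSpace ℂ H] [CompleteSpace H]
    [TopologicalSpace.SeparableSpace H]
    (A₁ A₂ : FlowAlgebra.MeasurableConnection d μ H) :
    FlowAlgebra.UnitarilyEquivalent A₁.rep A₂.rep ↔ FlowAlgebra.GaugeEquivalent A₁ A₂ := by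
  rw [FlowAlgebra.unitarilyEquivalent_rep_iff]
  constructor
  · rintro ⟨V, hV⟩
    exact FlowAlgebra.gaugeEquivalent_of_intertwines A₁ A₂ V hV
  · rintro ⟨u, hu, h⟩
    exact ⟨FlowAlgebra.gaugeUnitary μ hu, fun f F ξ =>
      FlowAlgebra.gaugeUnitary_op A₁ A₂ hu (h F) f ξ⟩
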